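/- Let $\|A\|_\infty=\max_i\sum_j|A_{ij}|$ for matrices, with value $0$ for a matrix without rows; for an index set $S$ let $X_S$ be the matrix of the columns of $X$ with index in $S$. All quantities below are indexed by $k\in\mathbb N$ (index suppressed unless needed), with $m=m_k\to\infty$; only $\sigma\ge 0$ is fixed. Let $X$ be a deterministic $n\times p$ matrix whose columns satisfy $\|X_j\|_2^2=n$, let $\beta^*\in\mathbb R^p$, $S=\mathrm{supp}(\beta^*)=\{j:\beta^*_j\ne0\}\neq\emptyset$, $s=|S|$, $p-s\ge2$, $\rho=\min_{i\in S}|\beta_i^*|$, and let $X$ be $S$-incoherent with parameter $\eta\in(0,1]$: $$\Big\|\tfrac1nX_{S^c}^TX_S\Big\|_\infty+\Big\|\tfrac1nX_S^TX_S-I_s\Big\|_\infty\le1-\eta .$$ The parameter $\eta=\eta_k$ may vary with $k$, provided that $\|\frac1nX_S^TX_S-I_s\|_\infty$ is bounded away from $1$ uniformly in $k$ (this is automatic if $\eta$ is constant). Let $Y=X\beta^*+\epsilon$ with $\epsilon\sim N(0,\sigma^2I_n)$, let $\Phi$ be an $m\times n$ random matrix, independent of $\epsilon$, with i.i.d. $N(0,1/n)$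 entries, and put $Z=\Phi X$, $W=\Phi Y$. With $C_1=4e/\sqrt{6\pi}$ and $C_2=\sqrt{8e}$ suppose $$\Big(\frac{16C_1s^2}{\eta^2}+\frac{4C_2s}{\eta}\Big)\big(\log p+2\log n+\log(2(s+1))\big)\le m\le\sqrt{\frac{n}{16\log n}},$$ and let $\lambda=\lambda_k>0$, $\lambda\to0$, satisfy $$(a)\ \frac{m\eta^2\lambda^2}{\log(p-s)}\to\infty,\qquad(b)\ \frac1\rho\Big\{\sqrt{\frac{\log s}{m}}+\lambda\Big\|\big(\tfrac1nX_S^TX_S\big)^{-1}\Big\|_\infty\Big\}\to0 .$$ Let $\tilde\Omega$ be the set of minimizers over $\beta\in\mathbb R^p$ of the compressed lasso objective $\frac1{2m}\|W-Z\beta\|_2^2+\lambda\|\beta\|_1$. Then the compressed lasso is sparsistent and sign consistent: as $k\to\infty$ (so $m\to\infty$), $$\mathbb P\big(\exists\tilde\beta\in\tilde\Omega:\ \mathrm{supp}(\tilde\beta)=\mathrm{supp}(\beta^*)\big)\to1,\qquad \mathbb P\big(\exists\tilde\beta\in\tilde\Omega:\ \mathrm{sgn}(\tilde\beta)=\mathrm{sgn}(\beta^*)\big)\to1,$$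 and indeed, with probability tending to $1$, $\tilde\Omega$ is nonempty and every $\tilde\beta\in\tilde\Omega$ satisfies $\mathrm{sgn}(\tilde\beta)=\mathrm{sgn}(\beta^*)$, hence $\mathrm{supp}(\tilde\beta)=\mathrm{supp}(\beta^*)$. -/

import Mathlib

open MeasureTheory ProbabilityTheory Filter Topology
open scoped NNReal ENNReal Matrix

noncomputable section

namespace CompressedLasso

/-- The matrix `∞`-norm (maximal absolute row sum), as provided by Mathlib's `L∞` operator norm
on rectangular matrices; it is `0` for a matrix without rows. -/
def infNorm {ι κ : Type*} [Fintype ι] [Fintype κ] (A : Matrix ι κ ℝ) : ℝ :=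
  letI : NormedAddCommGroup (Matrix ι κ ℝ) := Matrix.linftyOpNormedAddCommGroup
  ‖A‖

/-- The support of a parameter vector. -/
def supp {p : ℕ} (b : Fin p → ℝ) : Finset (Fin p) :=
  Finset.univ.filter fun j => b j ≠ 0

/-- The smallest absolute value of a nonzero coefficient of `b`
(used for vectors with nonempty support only). -/
def minCoeff {p : ℕ} (b : Fin p → ℝ) : ℝ :=
  ⨅ j : {j // j ∈ supp b}, |b j|

/-- The submatrix `X_S` formed by the columns of `X` with index in `S`. -/
def cols {n p : ℕ} (X : Matrix (Fin n) (Fin p) ℝ) (S : Finset (Fin p)) :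
    Matrix (Fin n) {j // j ∈ S} ℝ :=
  X.submatrix id Subtype.val

/-- The normalized Gram matrix `(1/n) X_Sᵀ X_S`. -/
def gram {n p : ℕ} (X : Matrix (Fin n) (Fin p) ℝ) (S : Finset (Fin p)) :
    Matrix {j // j ∈ S} {j // j ∈ S} ℝ :=
  (1 / (n : ℝ)) • ((cols X S)ᵀ * cols X S)

/-- `X` is `S`-incoherent with parameter `η`:  `S ≠ ∅`, `η ∈ (0, 1]` and
`‖(1/n) X_{Sᶜ}ᵀ X_S‖_∞ + ‖(1/n) X_Sᵀ X_S - I‖_∞ ≤ 1 - η`. -/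
def Incoherent {n p : ℕ} (X : Matrix (Fin n) (Fin p) ℝ) (S : Finset (Fin p)) (η : ℝ) : Prop :=
  S.Nonempty ∧ 0 < η ∧ η ≤ 1 ∧
    infNorm ((1 / (n : ℝ)) • ((cols X Sᶜ)ᵀ * cols X S)) + infNorm (gram X S - 1) ≤ 1 - η

/-- The lasso objective `(1/(2m)) ‖W - Z b‖₂² + lam ‖b‖₁`. -/
def lassoObjective {m p : ℕ} (Z : Matrix (Fin m) (Fin p) ℝ) (W : Fin m → ℝ) (lam : ℝ)
    (b : Fin p → ℝ) : ℝ :=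
  1 / (2 * (m : ℝ)) * ∑ i, (W i - (Z *ᵥ b) i) ^ 2 + lam * ∑ j, |b j|

/-- The set of optimal solutions of the lasso. -/
def lassoSolutions {m p : ℕ} (Z : Matrix (Fin m) (Fin p) ℝ) (W : Fin m → ℝ) (lam : ℝ) :
    Set (Fin p → ℝ) :=
  {b | ∀ b' : Fin p → ℝ, lassoObjective Z W lam b ≤ lassoObjective Z W lam b'}

/-- The optimal solutions of the compressed lasso: the data `X` and `Y = X β + ε` are replaced
by `Z = Φ X` and `W = Φ Y`. -/
def compressedLasso {m n p : ℕ} (Φ : Matrix (Fin m) (Fin n) ℝ) (X : Matrix (Fin n) (Fin p) ℝ)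
    (β : Fin p → ℝ) (ε : Fin n → ℝ) (lam : ℝ) : Set (Fin p → ℝ) :=
  lassoSolutions (Φ * X) (Φ *ᵥ (X *ᵥ β + ε)) lam

/-- `b` and `β` have the same coordinatewise signs (in `{-1, 0, 1}`). -/
def SameSigns {p : ℕ} (b β : Fin p → ℝ) : Prop :=
  ∀ j, SignType.sign (b j) = SignType.sign (β j)

/-- Sign consistency of a sequence of random sets of estimators. -/
def SignConsistent {Ω : ℕ → Type*} [∀ k, MeasurableSpace (Ω k)] (P : ∀ k, Measure (Ω k))
    {p : ℕ → ℕ} (est : ∀ k, Ω k → Set (Fin (p k) → ℝ)) (β : ∀ k, Fin (p k) → ℝ) : Prop :=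
  Tendsto (fun k => P k {ω | ∃ b ∈ est k ω, SameSigns b (β k)}) atTop (𝓝 1)

/-- Sparsistency of a sequence of random sets of estimators. -/
def Sparsistent {Ω : ℕ → Type*} [∀ k, MeasurableSpace (Ω k)] (P : ∀ k, Measure (Ω k))
    {p : ℕ → ℕ} (est : ∀ k, Ω k → Set (Fin (p k) → ℝ)) (β : ∀ k, Fin (p k) → ℝ) : Prop :=
  Tendsto (fun k => P k {ω | ∃ b ∈ est k ω, supp b = supp (β k)}) atTop (𝓝 1)

/-- `Φ` has `N(0, 1/n)` entries, `ε` has `N(0, σ²)` entries, and all these entries together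
are independent. -/
structure GaussianModel {Ω : Type*} [MeasurableSpace Ω] (P : Measure Ω) {m n : ℕ}
    (Φ : Ω → Matrix (Fin m) (Fin n) ℝ) (ε : Ω → Fin n → ℝ) (σ : ℝ≥0) : Prop where
  law_Φ : ∀ i j, HasLaw (fun ω => Φ ω i j) (gaussianReal 0 (1 / (n : ℝ≥0))) P
  law_ε : ∀ i, HasLaw (fun ω => ε ω i) (gaussianReal 0 (σ ^ 2)) P
  indep : iIndepFun
    (fun (t : (Fin m × Fin n) ⊕ Fin n) (ω : Ω) =>
      Sum.elim (fun ij : Fin m × Fin n => Φ ω ij.1 ij.2) (fun i : Fin n => ε ω i) t) P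

/-- The constant `C₁ = 4e / √(6π)`. -/
def C₁ : ℝ := 4 * Real.exp 1 / Real.sqrt (6 * Real.pi)

/-- The constant `C₂ = √(8e)`. -/
def C₂ : ℝ := Real.sqrt (8 * Real.exp 1)

end CompressedLasso

end

/-!
Write `Z = Φ X`, `S = supp β`, `A = (1/m) Z_Sᵀ Z_S`, `G = (1/n) X_Sᵀ X_S`, `a = ‖G - 1‖_∞`. The
proof is the primal-dual witness method (`lassoSolutions_sameSigns`): if the lasso restricted to
`S` does not change a sign on `S`, and its residual has correlation smaller than `λ` with every
column off `S`, then it is the only solution of the full lasso. It remains to control, for the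
random `Φ` and `ε`, the error `A⁻¹ ((1/m) Z_Sᵀ Φ ε - λ sgn β)` on `S` and the correlations off `S`.

Incoherence is used at the level of `X` only. The coefficients of the regression of an irrelevant
column `X_j` on `X_S` have `ℓ₁`-norm at most `1 - η / (1 - a)` (`sum_abs_regCoef_le`), and the
regression residual `R_j` is orthogonal to `X_S`, so that `Φ R_j` is independent of `Z_S`. Hence
the correlation of `Z_j` with the dual certificate `Z_S A⁻¹ sgn β` is at most `1 - η / (1 - a)` plus
a term that is Gaussian conditionally on `Z_S`, with variance of order `s / (m (1 - a))`
(`measureReal_le_abs_inner_image_residual`). The lower bound on `m` makes a union bound over `j`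
possible. No deviation inequality for the individual inner products `⟨Z_i, Z_j⟩` with `j ∉ S` is
needed.

Second moments suffice for the Gram matrices, because the lower bound on `m` gives
`s² / (m η²) = O(1 / log n)` and the upper bound gives `m² / n = O(1 / log n)`: with probability
tending to one, `‖A - G‖_F ≤ η / 2`, `‖(A - G) G⁻¹ sgn β‖₂ ≤ 1` and `‖Φ Φᵀ - 1‖_F ≤ 1`. The first
bound makes `A` coercive, the second compares the bias `λ A⁻¹ sgn β` with `λ G⁻¹ sgn β`
in the maximum norm, and the third shows that, conditionally on `Φ`, the noise `Φ ε` has covariance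
at most `2 σ²`, in spite of its dependence on `Z`. All remaining terms are then conditionally
Gaussian (`GaussianModel.measureReal_le_abs_noise`), and conditions (a) and (b) beat the union
bounds off and on `S`. The outcome is the explicit bound `failureBound`
(`measureReal_not_allSignsCorrect_le`), which tends to zero by `failureBound_le`.
-/

namespace CompressedLasso

/-! ### Quadratic forms and least squares -/

section LinearAlgebra

variable {ι κ : Type*} [Fintype ι] [Fintype κ]

lemma sum_abs_row_le_infNorm (A : Matrix ι κ ℝ) (i : ι) : ∑ j, |A i j| ≤ infNorm A := by
  have h : (∑ j, ‖A i j‖₊) ≤ Finset.univ.sup fun i : ι => ∑ j, ‖A i j‖₊ :=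
    Finset.le_sup (f := fun i : ι => ∑ j, ‖A i j‖₊) (Finset.mem_univ i)
  have h' : ((∑ j, ‖A i j‖₊ : ℝ≥0) : ℝ) ≤ infNorm A := by
    rw [infNorm, Matrix.linfty_opNorm_def]
    exact_mod_cast h
  simpa using h'

lemma infNorm_nonneg (A : Matrix ι κ ℝ) : 0 ≤ infNorm A := by
  rw [infNorm, Matrix.linfty_opNorm_def]
  exact NNReal.coe_nonneg _

/-- Schur's test for a symmetric kernel: row sums bound the quadratic form. -/
lemma abs_quadForm_le_of_row_sums {E : Matrix ι ι ℝ} (hE : E.IsSymm) {a : ℝ}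
    (ha : ∀ i, ∑ j, |E i j| ≤ a) (x : ι → ℝ) : |x ⬝ᵥ (E *ᵥ x)| ≤ a * ∑ i, x i ^ 2 := by
  have h1 : |x ⬝ᵥ (E *ᵥ x)| ≤ ∑ i, ∑ j, |E i j| * ((x i ^ 2 + x j ^ 2) / 2) := by
    simp only [dotProduct, Matrix.mulVec, Finset.mul_sum]
    refine (Finset.abs_sum_le_sum_abs _ _).trans (Finset.sum_le_sum fun i _ => ?_)
    refine (Finset.abs_sum_le_sum_abs _ _).trans (Finset.sum_le_sum fun j _ => ?_)
    have : |x i| * |x j| ≤ (x i ^ 2 + x j ^ 2) / 2 := by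
      nlinarith [sq_nonneg (|x i| - |x j|), sq_abs (x i), sq_abs (x j)]
    rw [abs_mul, abs_mul]
    nlinarith [mul_le_mul_of_nonneg_left this (abs_nonneg (E i j))]
  have h2 : ∑ i, ∑ j, |E i j| * (x j ^ 2) = ∑ i, ∑ j, |E i j| * (x i ^ 2) := by
    rw [Finset.sum_comm]
    refine Finset.sum_congr rfl fun i _ => Finset.sum_congr rfl fun j _ => ?_
    rw [hE.apply]
  have h3 : ∑ i, ∑ j, |E i j| * ((x i ^ 2 + x j ^ 2) / 2) = ∑ i, ∑ j, |E i j| * (x i ^ 2) := by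
    have : ∀ i j, |E i j| * ((x i ^ 2 + x j ^ 2) / 2)
        = (|E i j| * x i ^ 2) / 2 + (|E i j| * x j ^ 2) / 2 := fun i j => by ring
    simp only [this, Finset.sum_add_distrib, ← Finset.sum_div, h2]
    ring
  rw [h3] at h1
  refine h1.trans ?_
  rw [Finset.mul_sum]
  refine Finset.sum_le_sum fun i _ => ?_
  rw [← Finset.sum_mul]
  exact mul_le_mul_of_nonneg_right (ha i) (sq_nonneg _)

lemma abs_quadForm_le_of_sum_sq {D : Matrix ι ι ℝ} {r : ℝ} (hr : 0 ≤ r)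
    (hD : ∑ q : ι × ι, D q.1 q.2 ^ 2 ≤ r ^ 2) (x : ι → ℝ) :
    |x ⬝ᵥ (D *ᵥ x)| ≤ r * ∑ i, x i ^ 2 := by
  have h1 : x ⬝ᵥ (D *ᵥ x) = ∑ q : ι × ι, D q.1 q.2 * (x q.1 * x q.2) := by
    simp only [dotProduct, Matrix.mulVec, Finset.mul_sum, Fintype.sum_prod_type]
    exact Finset.sum_congr rfl fun i _ => Finset.sum_congr rfl fun j _ => by ring
  have h2 : ∑ q : ι × ι, (x q.1 * x q.2) ^ 2 = (∑ i, x i ^ 2) ^ 2 := by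
    rw [sq (∑ i, x i ^ 2), Finset.sum_mul_sum, Fintype.sum_prod_type]
    exact Finset.sum_congr rfl fun i _ => Finset.sum_congr rfl fun j _ => by ring
  have h3 := Finset.sum_mul_sq_le_sq_mul_sq Finset.univ (fun q : ι × ι => D q.1 q.2)
    (fun q => x q.1 * x q.2)
  have h0 : 0 ≤ ∑ i, x i ^ 2 := Finset.sum_nonneg fun i _ => sq_nonneg _
  refine abs_le_of_sq_le_sq ?_ (by positivity)
  rw [h1, mul_pow, ← h2]
  exact h3.trans (mul_le_mul_of_nonneg_right hD (Finset.sum_nonneg fun _ _ => sq_nonneg _))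

lemma isUnit_det_of_coercive [DecidableEq ι] {A : Matrix ι ι ℝ} {c : ℝ} (hc : 0 < c)
    (hA : ∀ x, c * ∑ i, x i ^ 2 ≤ x ⬝ᵥ (A *ᵥ x)) : IsUnit A.det := by
  rw [isUnit_iff_ne_zero]
  intro h
  obtain ⟨x, hx, hx0⟩ := Matrix.exists_mulVec_eq_zero_iff.2 h
  have := hA x
  rw [hx0, dotProduct_zero] at this
  have h0 : 0 ≤ ∑ i, x i ^ 2 := Finset.sum_nonneg fun i _ => sq_nonneg _
  have h1 : ∑ i, x i ^ 2 = 0 := by nlinarith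
  refine hx (funext fun i => ?_)
  have := (Finset.sum_eq_zero_iff_of_nonneg fun i _ => sq_nonneg (x i)).1 h1 i (Finset.mem_univ i)
  simpa using this

lemma mulVec_inv_mulVec [DecidableEq ι] {A : Matrix ι ι ℝ} (hA : IsUnit A.det) (u : ι → ℝ) :
    A *ᵥ (A⁻¹ *ᵥ u) = u := by
  rw [Matrix.mulVec_mulVec, Matrix.mul_nonsing_inv _ hA, Matrix.one_mulVec]

lemma dotProduct_le_of_coercive {A : Matrix ι ι ℝ} {c : ℝ} (hc : 0 < c)
    (hA : ∀ x, c * ∑ i, x i ^ 2 ≤ x ⬝ᵥ (A *ᵥ x)) {d u : ι → ℝ} (hd : A *ᵥ d = u) :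
    d ⬝ᵥ u ≤ (∑ i, u i ^ 2) / c := by
  have h1 := hA d
  rw [hd] at h1
  have h2 : d ⬝ᵥ u ≤ c / 2 * ∑ i, d i ^ 2 + (∑ i, u i ^ 2) / (2 * c) := by
    rw [Finset.mul_sum, Finset.sum_div, ← Finset.sum_add_distrib]
    refine Finset.sum_le_sum fun i _ => ?_
    have : c / 2 * d i ^ 2 + u i ^ 2 / (2 * c) - d i * u i = (c * d i - u i) ^ 2 / (2 * c) := by
      field_simp
      ring
    have : 0 ≤ (c * d i - u i) ^ 2 / (2 * c) := by positivity
    linarith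
  have h3 : (∑ i, u i ^ 2) / (2 * c) = (∑ i, u i ^ 2) / c / 2 := by
    field_simp
  linarith

lemma sum_sq_le_of_coercive {A : Matrix ι ι ℝ} {c : ℝ} (hc : 0 < c)
    (hA : ∀ x, c * ∑ i, x i ^ 2 ≤ x ⬝ᵥ (A *ᵥ x)) {d u : ι → ℝ} (hd : A *ᵥ d = u) :
    ∑ i, d i ^ 2 ≤ (∑ i, u i ^ 2) / c ^ 2 := by
  have h1 := hA d
  rw [hd] at h1
  have h2 := dotProduct_le_of_coercive hc hA hd
  rw [le_div_iff₀ hc] at h2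
  rw [le_div_iff₀ (by positivity)]
  nlinarith

/-- The empirical Gram matrix `(1/c) Mᵀ M`. -/
noncomputable def normGram {ι κ : Type*} [Fintype κ] (c : ℝ) (M : Matrix κ ι ℝ) :
    Matrix ι ι ℝ := (1 / c) • (Mᵀ * M)

lemma normGram_isSymm {ι κ : Type*} [Fintype κ] (c : ℝ) (M : Matrix κ ι ℝ) :
    (normGram c M).IsSymm := by
  rw [normGram, Matrix.IsSymm, Matrix.transpose_smul, Matrix.transpose_mul,
    Matrix.transpose_transpose]

lemma normGram_apply {ι κ : Type*} [Fintype κ] (c : ℝ) (M : Matrix κ ι ℝ) (i j : ι) :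
    normGram c M i j = 1 / c * ∑ l, M l i * M l j := by
  simp [normGram, Matrix.mul_apply]

lemma dotProduct_normGram_mulVec (c : ℝ) (M : Matrix κ ι ℝ) (x y : ι → ℝ) :
    x ⬝ᵥ (normGram c M *ᵥ y) = 1 / c * ((M *ᵥ x) ⬝ᵥ (M *ᵥ y)) := by
  rw [normGram, Matrix.smul_mulVec, dotProduct_smul, smul_eq_mul, ← Matrix.mulVec_mulVec,
    Matrix.dotProduct_mulVec, Matrix.vecMul_transpose]

lemma normGram_mulVec (c : ℝ) (M : Matrix κ ι ℝ) (y : ι → ℝ) :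
    normGram c M *ᵥ y = (1 / c) • (Mᵀ *ᵥ (M *ᵥ y)) := by
  rw [normGram, Matrix.smul_mulVec, ← Matrix.mulVec_mulVec]

/-- The coefficients of the least-squares regression of `z` on the columns of `M`. -/
noncomputable def regCoef [DecidableEq ι] (c : ℝ) (M : Matrix κ ι ℝ) (z : κ → ℝ) : ι → ℝ :=
  (normGram c M)⁻¹ *ᵥ ((1 / c) • (Mᵀ *ᵥ z))

/-- The residual of the least-squares regression of `z` on the columns of `M`. -/
noncomputable def residual [DecidableEq ι] (c : ℝ) (M : Matrix κ ι ℝ) (z : κ → ℝ) : κ → ℝ :=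
  z - M *ᵥ regCoef c M z

variable [DecidableEq ι]

lemma transpose_mulVec_residual {c : ℝ} (hc : c ≠ 0) {M : Matrix κ ι ℝ}
    (hM : IsUnit (normGram c M).det) (z : κ → ℝ) : Mᵀ *ᵥ residual c M z = 0 := by
  have h := mulVec_inv_mulVec hM ((1 / c) • (Mᵀ *ᵥ z))
  change normGram c M *ᵥ regCoef c M z = _ at h
  rw [normGram_mulVec] at h
  have h' := smul_right_injective (ι → ℝ) (one_div_ne_zero hc) h
  rw [residual, Matrix.mulVec_sub, h', sub_self]

lemma dotProduct_residual_mulVec {c : ℝ} (hc : c ≠ 0) {M : Matrix κ ι ℝ}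
    (hM : IsUnit (normGram c M).det) (z : κ → ℝ) (x : ι → ℝ) :
    (M *ᵥ x) ⬝ᵥ residual c M z = 0 := by
  rw [← Matrix.vecMul_transpose, ← Matrix.dotProduct_mulVec, transpose_mulVec_residual hc hM,
    dotProduct_zero]

lemma sum_sq_residual_le {c : ℝ} (hc : c ≠ 0) {M : Matrix κ ι ℝ}
    (hM : IsUnit (normGram c M).det) (z : κ → ℝ) :
    ∑ l, residual c M z l ^ 2 ≤ ∑ l, z l ^ 2 := by
  have h := dotProduct_residual_mulVec hc hM z (regCoef c M z)
  have hz : ∀ l, z l = residual c M z l + (M *ᵥ regCoef c M z) l := fun l => by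
    simp [residual]
  have e : ∑ l, z l ^ 2 = ∑ l, residual c M z l ^ 2
      + 2 * ((M *ᵥ regCoef c M z) ⬝ᵥ residual c M z) + ∑ l, (M *ᵥ regCoef c M z) l ^ 2 := by
    rw [dotProduct, Finset.mul_sum, ← Finset.sum_add_distrib, ← Finset.sum_add_distrib]
    refine Finset.sum_congr rfl fun l _ => ?_
    rw [hz l]
    ring
  rw [e, h]
  have : 0 ≤ ∑ l, (M *ᵥ regCoef c M z) l ^ 2 := Finset.sum_nonneg fun _ _ => sq_nonneg _
  linarith

/-- The residual map is self-adjoint, also when the Gram matrix is singular and its inverse has the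
junk value `0`. -/
lemma residual_dotProduct (c : ℝ) (M : Matrix κ ι ℝ) (z w : κ → ℝ) :
    residual c M z ⬝ᵥ w = z ⬝ᵥ residual c M w := by
  have key : ∀ a b : κ → ℝ, (M *ᵥ regCoef c M a) ⬝ᵥ b
      = 1 / c * ((Mᵀ *ᵥ a) ⬝ᵥ ((normGram c M)⁻¹ *ᵥ (Mᵀ *ᵥ b))) := by
    intro a b
    have hs : ((normGram c M)⁻¹)ᵀ = (normGram c M)⁻¹ := by
      rw [Matrix.transpose_nonsing_inv, (normGram_isSymm c M)]
    rw [← Matrix.vecMul_transpose, ← Matrix.dotProduct_mulVec, regCoef, Matrix.mulVec_smul,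
      smul_dotProduct, smul_eq_mul, ← Matrix.vecMul_transpose, hs, ← Matrix.dotProduct_mulVec]
  have key2 : z ⬝ᵥ (M *ᵥ regCoef c M w)
      = 1 / c * ((Mᵀ *ᵥ z) ⬝ᵥ ((normGram c M)⁻¹ *ᵥ (Mᵀ *ᵥ w))) := by
    rw [Matrix.dotProduct_mulVec, ← Matrix.mulVec_transpose, regCoef, Matrix.mulVec_smul,
      dotProduct_smul, smul_eq_mul]
  rw [residual, residual, sub_dotProduct, dotProduct_sub, key, key2]

/-- If `‖G - 1‖_∞ ≤ a < 1` for a symmetric `G`, then the `ℓ₁` operator norm of `G⁻¹` is at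
most `1 / (1 - a)`. -/
lemma sum_abs_le_of_mulVec_eq {G : Matrix ι ι ℝ} (hG : G.IsSymm) {a : ℝ} (ha1 : a < 1)
    (ha : ∀ i, ∑ j, |(G - 1) i j| ≤ a) {α h : ι → ℝ} (hα : G *ᵥ α = h) :
    ∑ i, |α i| ≤ (∑ i, |h i|) / (1 - a) := by
  have e : ∀ i, α i = h i - ((G - 1) *ᵥ α) i := fun i => by
    rw [Matrix.sub_mulVec, hα, Matrix.one_mulVec]; simp
  have hsymm : (G - 1).IsSymm := hG.sub (Matrix.isSymm_one)
  have h1 : ∑ i, |((G - 1) *ᵥ α) i| ≤ a * ∑ i, |α i| := by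
    calc ∑ i, |((G - 1) *ᵥ α) i| ≤ ∑ i, ∑ j, |(G - 1) i j| * |α j| := by
          refine Finset.sum_le_sum fun i _ => ?_
          simp only [Matrix.mulVec, dotProduct]
          refine (Finset.abs_sum_le_sum_abs _ _).trans (Finset.sum_le_sum fun j _ => ?_)
          rw [abs_mul]
      _ = ∑ j, (∑ i, |(G - 1) j i|) * |α j| := by
          rw [Finset.sum_comm]
          refine Finset.sum_congr rfl fun j _ => ?_
          rw [Finset.sum_mul]
          refine Finset.sum_congr rfl fun i _ => ?_
          rw [hsymm.apply]
      _ ≤ ∑ j, a * |α j| :=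
          Finset.sum_le_sum fun j _ => mul_le_mul_of_nonneg_right (ha j) (abs_nonneg _)
      _ = a * ∑ i, |α i| := by rw [Finset.mul_sum]
  have h2 : ∑ i, |α i| ≤ ∑ i, |h i| + ∑ i, |((G - 1) *ᵥ α) i| := by
    rw [← Finset.sum_add_distrib]
    refine Finset.sum_le_sum fun i _ => ?_
    conv_lhs => rw [e i]
    exact abs_sub _ _
  rw [le_div_iff₀ (by linarith)]
  nlinarith

lemma half_le_infNorm_inv [Nonempty ι] {G : Matrix ι ι ℝ} (hdet : IsUnit G.det)
    (hG : ∀ i j, |G i j| ≤ 2) : 1 / 2 ≤ infNorm G⁻¹ := by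
  obtain ⟨i⟩ := ‹Nonempty ι›
  have h1 : (G⁻¹ * G) i i = 1 := by rw [Matrix.nonsing_inv_mul _ hdet]; simp
  rw [Matrix.mul_apply] at h1
  have h2 : (1 : ℝ) ≤ ∑ j, |G⁻¹ i j| * 2 := by
    rw [← h1]
    refine Finset.sum_le_sum fun j _ => ?_
    refine (le_abs_self _).trans ?_
    rw [abs_mul]
    exact mul_le_mul_of_nonneg_left (hG j i) (abs_nonneg _)
  rw [← Finset.sum_mul] at h2
  have := sum_abs_row_le_infNorm G⁻¹ i
  linarith

end LinearAlgebra

/-! ### The primal-dual witness -/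

section Witness

variable {m p : ℕ}

/-- The vector on all indices extending `d` by zero off `S`. -/
def extendZero (S : Finset (Fin p)) (d : {j // j ∈ S} → ℝ) : Fin p → ℝ :=
  fun j => if h : j ∈ S then d ⟨j, h⟩ else 0

lemma mulVec_extendZero (Z : Matrix (Fin m) (Fin p) ℝ) (S : Finset (Fin p))
    (d : {j // j ∈ S} → ℝ) : Z *ᵥ extendZero S d = cols Z S *ᵥ d := by
  funext l
  simp only [Matrix.mulVec, dotProduct, cols, Matrix.submatrix_apply, id, extendZero]
  rw [← Finset.sum_subset (Finset.subset_univ S)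
    (f := fun j => Z l j * if h : j ∈ S then d ⟨j, h⟩ else 0)]
  · rw [← Finset.sum_coe_sort]
    exact Finset.sum_congr rfl fun j _ => by simp [j.2]
  · intro j _ hj
    simp [hj]

/-- Second-order expansion of the lasso objective at `b`, in terms of the gradient
`g = (1/m) Zᵀ (W - Z b)`. -/
lemma lassoObjective_sub (hm : (m : ℝ) ≠ 0) (Z : Matrix (Fin m) (Fin p) ℝ) (W : Fin m → ℝ)
    (lam : ℝ) (b b' : Fin p → ℝ) :
    lassoObjective Z W lam b' - lassoObjective Z W lam b =
      1 / (2 * (m : ℝ)) * ∑ i, (Z *ᵥ (b' - b)) i ^ 2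
      + ∑ j, ((lam * |b' j| - (1 / (m : ℝ) * ((Z.col j) ⬝ᵥ (W - Z *ᵥ b))) * b' j)
        - (lam * |b j| - (1 / (m : ℝ) * ((Z.col j) ⬝ᵥ (W - Z *ᵥ b))) * b j)) := by
  have h1 : ∑ j, ((Z.col j) ⬝ᵥ (W - Z *ᵥ b)) * (b' - b) j
      = (W - Z *ᵥ b) ⬝ᵥ (Z *ᵥ (b' - b)) := by
    rw [Matrix.dotProduct_mulVec]
    simp only [dotProduct, Matrix.vecMul]
    refine Finset.sum_congr rfl fun j _ => ?_
    congr 1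
    exact Finset.sum_congr rfl fun l _ => by simp [mul_comm]
  have h2 : ∑ i, (W i - (Z *ᵥ b') i) ^ 2 = ∑ i, (W i - (Z *ᵥ b) i) ^ 2
      - 2 * ((W - Z *ᵥ b) ⬝ᵥ (Z *ᵥ (b' - b))) + ∑ i, (Z *ᵥ (b' - b)) i ^ 2 := by
    rw [dotProduct, Finset.mul_sum, ← Finset.sum_sub_distrib, ← Finset.sum_add_distrib]
    refine Finset.sum_congr rfl fun i _ => ?_
    rw [Matrix.mulVec_sub]
    simp only [Pi.sub_apply]
    ring
  have h3 : ∑ j, ((lam * |b' j| - (1 / (m : ℝ) * ((Z.col j) ⬝ᵥ (W - Z *ᵥ b))) * b' j)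
        - (lam * |b j| - (1 / (m : ℝ) * ((Z.col j) ⬝ᵥ (W - Z *ᵥ b))) * b j))
      = lam * ∑ j, |b' j| - lam * ∑ j, |b j|
        - 1 / (m : ℝ) * ∑ j, ((Z.col j) ⬝ᵥ (W - Z *ᵥ b)) * (b' - b) j := by
    rw [Finset.mul_sum, Finset.mul_sum, Finset.mul_sum, ← Finset.sum_sub_distrib,
      ← Finset.sum_sub_distrib]
    refine Finset.sum_congr rfl fun j _ => ?_
    simp only [Pi.sub_apply]
    ring
  rw [h3, h1, lassoObjective, lassoObjective, h2]
  field_simp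
  ring

/-- A strictly dual feasible point is the unique lasso solution. -/
lemma lassoSolutions_eq_singleton (hm : 0 < (m : ℝ)) {Z : Matrix (Fin m) (Fin p) ℝ}
    {W : Fin m → ℝ} {lam : ℝ} {S : Finset (Fin p)} {b : Fin p → ℝ}
    (hinj : ∀ x : {j // j ∈ S} → ℝ, cols Z S *ᵥ x = 0 → x = 0)
    (hb : ∀ j ∉ S, b j = 0)
    (hS : ∀ j ∈ S, 1 / (m : ℝ) * ((Z.col j) ⬝ᵥ (W - Z *ᵥ b)) * b j = lam * |b j| ∧
      |1 / (m : ℝ) * ((Z.col j) ⬝ᵥ (W - Z *ᵥ b))| ≤ lam)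
    (hSc : ∀ j ∉ S, |1 / (m : ℝ) * ((Z.col j) ⬝ᵥ (W - Z *ᵥ b))| < lam) :
    lassoSolutions Z W lam = {b} := by
  set g : Fin p → ℝ := fun j => 1 / (m : ℝ) * ((Z.col j) ⬝ᵥ (W - Z *ᵥ b)) with hg
  have hb0 : ∀ j, lam * |b j| - g j * b j = 0 := fun j => by
    by_cases hj : j ∈ S
    · have := (hS j hj).1
      simp only [hg]; linarith
    · simp [hb j hj]
  have hgle : ∀ j, |g j| ≤ lam := fun j => by
    by_cases hj : j ∈ S
    · exact (hS j hj).2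
    · exact (hSc j hj).le
  have hnn : ∀ (b' : Fin p → ℝ) j, 0 ≤ lam * |b' j| - g j * b' j := fun b' j => by
    have h1 : g j * b' j ≤ |g j| * |b' j| := by rw [← abs_mul]; exact le_abs_self _
    nlinarith [mul_le_mul_of_nonneg_right (hgle j) (abs_nonneg (b' j))]
  have hexp : ∀ b', lassoObjective Z W lam b' - lassoObjective Z W lam b =
      1 / (2 * (m : ℝ)) * ∑ i, (Z *ᵥ (b' - b)) i ^ 2 + ∑ j, (lam * |b' j| - g j * b' j) := by
    intro b'
    rw [lassoObjective_sub hm.ne']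
    congr 1
    refine Finset.sum_congr rfl fun j _ => ?_
    have := hb0 j
    simp only [hg] at this ⊢
    rw [this, sub_zero]
  have hsq : ∀ b', 0 ≤ 1 / (2 * (m : ℝ)) * ∑ i, (Z *ᵥ (b' - b)) i ^ 2 := fun b' =>
    mul_nonneg (by positivity) (Finset.sum_nonneg fun _ _ => sq_nonneg _)
  have hmin : b ∈ lassoSolutions Z W lam := by
    intro b'
    have h1 := hexp b'
    have h2 := hsq b'
    have h3 : 0 ≤ ∑ j, (lam * |b' j| - g j * b' j) := Finset.sum_nonneg fun j _ => hnn b' j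
    linarith
  ext b'
  rw [Set.mem_singleton_iff]
  refine ⟨fun hb' => ?_, fun h => h ▸ hmin⟩
  have h1 := hexp b'
  have h2 := hsq b'
  have h3 : 0 ≤ ∑ j, (lam * |b' j| - g j * b' j) := Finset.sum_nonneg fun j _ => hnn b' j
  have h4 := hb' b
  have h5 : ∑ j, (lam * |b' j| - g j * b' j) = 0 := by linarith
  have h6 : 1 / (2 * (m : ℝ)) * ∑ i, (Z *ᵥ (b' - b)) i ^ 2 = 0 := by linarith
  have h7 : ∀ j, lam * |b' j| - g j * b' j = 0 := fun j =>
    (Finset.sum_eq_zero_iff_of_nonneg fun j _ => hnn b' j).1 h5 j (Finset.mem_univ j)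
  have h8 : ∀ j ∉ S, b' j = 0 := by
    intro j hj
    by_contra hne
    have h9 : g j * b' j ≤ |g j| * |b' j| := by rw [← abs_mul]; exact le_abs_self _
    have h10 := mul_lt_mul_of_pos_right (hSc j hj) (abs_pos.2 hne)
    have := h7 j
    linarith
  have h9 : Z *ᵥ (b' - b) = 0 := by
    have : ∑ i, (Z *ᵥ (b' - b)) i ^ 2 = 0 := by
      rcases mul_eq_zero.1 h6 with h | h
      · exact absurd h (by positivity)
      · exact h
    funext i
    have := (Finset.sum_eq_zero_iff_of_nonneg fun i _ => sq_nonneg ((Z *ᵥ (b' - b)) i)).1 this i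
      (Finset.mem_univ i)
    simpa using this
  have h10 : b' - b = extendZero S (fun j => b' j - b j) := by
    funext j
    by_cases hj : j ∈ S
    · simp [extendZero, hj]
    · simp [extendZero, hj, h8 j hj, hb j hj]
  rw [h10, mulVec_extendZero] at h9
  have h11 := hinj _ h9
  funext j
  by_cases hj : j ∈ S
  · have := congrFun h11 ⟨j, hj⟩
    simp only [Pi.zero_apply] at this
    linarith
  · rw [h8 j hj, hb j hj]

/-- The vector of signs of `β` on an index set `S`. -/
noncomputable def signOn (β : Fin p → ℝ) (S : Finset (Fin p)) : {j // j ∈ S} → ℝ :=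
  fun j => (SignType.sign (β j) : ℝ)

lemma signOn_sq {β : Fin p → ℝ} (i : {j // j ∈ supp β}) : signOn β (supp β) i ^ 2 = 1 := by
  have : β i ≠ 0 := by simpa [supp] using i.2
  rcases lt_or_gt_of_ne this with h | h <;> simp [signOn, h]

lemma sign_add_eq_of_abs_lt {x d : ℝ} (h : |d| < |x|) :
    SignType.sign (x + d) = SignType.sign x := by
  rcases lt_trichotomy x 0 with hx | hx | hx
  · rw [abs_of_neg hx] at h
    rw [sign_neg hx, sign_neg (by linarith [le_abs_self d])]
  · subst hx
    simp at h
    exact absurd h (not_lt.2 (abs_nonneg d))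
  · rw [abs_of_pos hx] at h
    rw [sign_pos hx, sign_pos (by linarith [neg_abs_le d])]

/-- **Primal-dual witness.** For the observations `W = Z β + w`, put
`A = (1/m) Z_Sᵀ Z_S` with `S = supp β`. The lasso has sign-correct solutions only, if the
restricted solution `β + A⁻¹ ((1/m) Z_Sᵀ w - λ sgn β)` has not changed any sign on `S`, and the
gradient is smaller than `λ` off `S`. -/
lemma lassoSolutions_sameSigns (hm : 0 < (m : ℝ)) {Z : Matrix (Fin m) (Fin p) ℝ}
    {β : Fin p → ℝ} {w : Fin m → ℝ} {lam : ℝ} (hlam : 0 < lam)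
    (hdet : IsUnit (normGram (m : ℝ) (cols Z (supp β))).det)
    (hU : ∀ i, |regCoef m (cols Z (supp β)) w i|
      + lam * |((normGram (m : ℝ) (cols Z (supp β)))⁻¹ *ᵥ signOn β (supp β)) i| < |β i|)
    (hV : ∀ j ∉ supp β, |1 / (m : ℝ) * (Z.col j ⬝ᵥ residual m (cols Z (supp β)) w)|
      + lam * |1 / (m : ℝ) * (Z.col j ⬝ᵥ (cols Z (supp β) *ᵥ
          ((normGram (m : ℝ) (cols Z (supp β)))⁻¹ *ᵥ signOn β (supp β))))| < lam) :
    (lassoSolutions Z (Z *ᵥ β + w) lam).Nonempty ∧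
      ∀ b ∈ lassoSolutions Z (Z *ᵥ β + w) lam, SameSigns b β ∧ supp b = supp β := by
  set S := supp β with hSdef
  set ZS := cols Z S with hZS
  set A := normGram (m : ℝ) ZS with hA
  set d2 := A⁻¹ *ᵥ signOn β S with hd2
  set d1 := regCoef m ZS w with hd1
  set b := β + extendZero S (d1 - lam • d2) with hbdef
  have hAd2 : A *ᵥ d2 = signOn β S := mulVec_inv_mulVec hdet _
  have hres : Z *ᵥ β + w - Z *ᵥ b = residual m ZS w + lam • (ZS *ᵥ d2) := by
    rw [hbdef, Matrix.mulVec_add, mulVec_extendZero, residual, Matrix.mulVec_sub,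
      Matrix.mulVec_smul]
    abel
  have hdl : ∀ i : {j // j ∈ S}, |(d1 - lam • d2) i| < |β i| := by
    intro i
    refine lt_of_le_of_lt ?_ (hU i)
    simp only [Pi.sub_apply, Pi.smul_apply, smul_eq_mul]
    refine (abs_sub _ _).trans ?_
    rw [abs_mul, abs_of_pos hlam]
  have hsign : SameSigns b β := by
    intro j
    by_cases hj : j ∈ S
    · have : b j = β j + (d1 - lam • d2) ⟨j, hj⟩ := by simp [hbdef, extendZero, hj]
      rw [this]
      exact sign_add_eq_of_abs_lt (hdl ⟨j, hj⟩)
    · simp [hbdef, extendZero, hj]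
  have hsupp : supp b = supp β := by
    ext j
    have := hsign j
    simp only [supp, Finset.mem_filter, Finset.mem_univ, true_and]
    rw [← sign_ne_zero, this, sign_ne_zero]
  have hgS : ∀ j (hj : j ∈ S), 1 / (m : ℝ) * ((Z.col j) ⬝ᵥ (Z *ᵥ β + w - Z *ᵥ b))
      = lam * signOn β S ⟨j, hj⟩ := by
    intro j hj
    have h1 : (Z.col j) ⬝ᵥ residual m ZS w = 0 := by
      have := congrFun (transpose_mulVec_residual hm.ne' hdet w) ⟨j, hj⟩
      exact this
    have h2 : 1 / (m : ℝ) * ((Z.col j) ⬝ᵥ (ZS *ᵥ d2)) = signOn β S ⟨j, hj⟩ := by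
      have := congrFun hAd2 ⟨j, hj⟩
      rw [hA, normGram_mulVec] at this
      exact this
    rw [hres, dotProduct_add, h1, dotProduct_smul, smul_eq_mul, zero_add, ← h2]
    ring
  have heq : lassoSolutions Z (Z *ᵥ β + w) lam = {b} := by
    refine lassoSolutions_eq_singleton hm (S := S) ?_ ?_ ?_ ?_
    · intro x hx
      have h1 : A *ᵥ x = 0 := by
        rw [hA, normGram_mulVec, hx, Matrix.mulVec_zero, smul_zero]
      by_contra hne
      exact hdet.ne_zero (Matrix.exists_mulVec_eq_zero_iff.1 ⟨x, hne, h1⟩)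
    · intro j hj
      have : β j = 0 := by simpa [hSdef, supp] using hj
      simp [hbdef, extendZero, hj, this]
    · intro j hj
      rw [hgS j hj]
      have hsb : signOn β S ⟨j, hj⟩ = (SignType.sign (b j) : ℝ) := by
        rw [hsign j]; rfl
      constructor
      · rw [hsb, mul_assoc, sign_mul_self]
      · rw [abs_mul, abs_of_pos hlam]
        have h1 : signOn β S ⟨j, hj⟩ ^ 2 = 1 := signOn_sq ⟨j, hj⟩
        have h2 : |signOn β S ⟨j, hj⟩| = 1 := by
          rcases mul_self_eq_one_iff.1 ((sq _).symm.trans h1) with h | h <;> simp [h]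
        rw [h2, mul_one]
    · intro j hj
      refine lt_of_le_of_lt ?_ (hV j hj)
      rw [hres, dotProduct_add, dotProduct_smul, smul_eq_mul, mul_add]
      refine (abs_add_le _ _).trans (le_of_eq ?_)
      congr 1
      rw [mul_left_comm, abs_mul, abs_of_pos hlam]
  rw [heq]
  refine ⟨Set.singleton_nonempty b, fun b' hb' => ?_⟩
  rw [Set.mem_singleton_iff.1 hb']
  exact ⟨hsign, hsupp⟩

end Witness

/-! ### Linear forms in independent Gaussian variables -/

section Gaussian

variable {Ω τ : Type*} [MeasurableSpace Ω] {P : Measure Ω}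

/-- `X` is a family of independent `N(0, v)` random variables. -/
structure IIDGaussian (P : Measure Ω) (X : τ → Ω → ℝ) (v : ℝ≥0) : Prop where
  law : ∀ t, HasLaw (X t) (gaussianReal 0 v) P
  indep : iIndepFun X P

variable {X : τ → Ω → ℝ} {v : ℝ≥0}

namespace IIDGaussian

lemma isProbabilityMeasure (h : IIDGaussian P X v) : IsProbabilityMeasure P :=
  h.indep.isProbabilityMeasure

lemma memLp_two (h : IIDGaussian P X v) (t : τ) : MemLp (X t) 2 P :=
  (h.law t).hasGaussianLaw.memLp_two

lemma integral_eq_zero (h : IIDGaussian P X v) (t : τ) : ∫ ω, X t ω ∂P = 0 := by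
  rw [(h.law t).integral_eq, integral_id_gaussianReal]

end IIDGaussian

variable [Fintype τ]

/-- The linear form `∑ c_t X_t`. -/
def linForm (X : τ → Ω → ℝ) (c : τ → ℝ) (ω : Ω) : ℝ := ∑ t, c t * X t ω

/-- `linForm` as a continuous linear map on the space of values. -/
noncomputable def linFormCLM (c : τ → ℝ) : (τ → ℝ) →L[ℝ] ℝ :=
  ∑ t, c t • ContinuousLinearMap.proj (R := ℝ) t

lemma linFormCLM_apply {Ω : Type*} {X : τ → Ω → ℝ} (c : τ → ℝ) (ω : Ω) :
    linFormCLM c (fun t => X t ω) = linForm X c ω := by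
  simp [linFormCLM, linForm]

namespace IIDGaussian

lemma hasGaussianLaw (h : IIDGaussian P X v) : HasGaussianLaw (fun ω => (X · ω)) P :=
  h.indep.hasGaussianLaw fun t => (h.law t).hasGaussianLaw

lemma hasGaussianLaw_linForm (h : IIDGaussian P X v) (c : τ → ℝ) :
    HasGaussianLaw (linForm X c) P := by
  have := h.hasGaussianLaw.map_fun (linFormCLM c)
  exact this.congr (Eventually.of_forall fun ω => linFormCLM_apply c ω)

lemma integral_linForm (h : IIDGaussian P X v) (c : τ → ℝ) : ∫ ω, linForm X c ω ∂P = 0 := by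
  simp only [linForm]
  rw [integral_finsetSum _ fun t _ =>
    ((h.law t).hasGaussianLaw.integrable.const_mul (c t))]
  simp [integral_const_mul, h.integral_eq_zero]

lemma covariance_linForm (h : IIDGaussian P X v) (c d : τ → ℝ) :
    cov[linForm X c, linForm X d; P] = v * ∑ t, c t * d t := by
  classical
  have := h.isProbabilityMeasure
  have e : cov[linForm X c, linForm X d; P]
      = ∑ t, ∑ u, cov[fun ω => c t * X t ω, fun ω => d u * X u ω; P] :=
    covariance_fun_sum_fun_sum (fun t => (h.memLp_two t).const_mul _)
      (fun t => (h.memLp_two t).const_mul _)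
  rw [e, Finset.mul_sum]
  refine Finset.sum_congr rfl fun t _ => ?_
  rw [Finset.sum_eq_single t]
  · rw [covariance_const_mul_left, covariance_const_mul_right,
      covariance_self (h.memLp_two t).aemeasurable, (h.law t).variance_eq,
      variance_id_gaussianReal]
    ring
  · intro u _ hu
    rw [covariance_const_mul_left, covariance_const_mul_right,
      (h.indep.indepFun hu.symm).covariance_eq_zero (h.memLp_two t) (h.memLp_two u)]
    simp
  · simp

lemma variance_linForm (h : IIDGaussian P X v) (c : τ → ℝ) :
    Var[linForm X c; P] = v * ∑ t, c t ^ 2 := by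
  rw [← covariance_self (h.hasGaussianLaw_linForm c).aemeasurable, h.covariance_linForm]
  simp only [sq]

lemma map_linForm (h : IIDGaussian P X v) (c : τ → ℝ) :
    P.map (linForm X c) = gaussianReal 0 (v * ∑ t, c t ^ 2).toNNReal := by
  rw [(h.hasGaussianLaw_linForm c).map_eq_gaussianReal, h.variance_linForm]
  congr 1
  exact h.integral_linForm c

/-- Orthogonal groups of linear forms are independent. -/
lemma indepFun_linForm (h : IIDGaussian P X v) {α β : Type*} [Fintype α] [Fintype β]
    {c : α → τ → ℝ} {d : β → τ → ℝ} (hcd : ∀ a b, ∑ t, c a t * d b t = 0) :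
    IndepFun (fun ω a => linForm X (c a) ω) (fun ω b => linForm X (d b) ω) P := by
  refine HasGaussianLaw.indepFun_of_covariance_eval (X := fun a => linForm X (c a))
    (Y := fun b => linForm X (d b)) ?_ fun a b => ?_
  · have := h.hasGaussianLaw.map_fun
      ((ContinuousLinearMap.pi fun a => linFormCLM (c a)).prod
        (ContinuousLinearMap.pi fun b => linFormCLM (d b)))
    refine this.congr (Eventually.of_forall fun ω => ?_)
    exact Prod.ext (funext fun a => linFormCLM_apply (c a) ω)
      (funext fun b => linFormCLM_apply (d b) ω)
  · rw [h.covariance_linForm, hcd, mul_zero]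

lemma iIndepFun_linForm (h : IIDGaussian P X v) {ι α : Type*} [Fintype ι] [Fintype α]
    {c : ι → α → τ → ℝ} (hc : ∀ i j, i ≠ j → ∀ a b, ∑ t, c i a t * c j b t = 0) :
    iIndepFun (fun i ω a => linForm X (c i a) ω) P := by
  refine HasGaussianLaw.iIndepFun_of_covariance_eval
    (X := fun i a => linForm X (c i a)) ?_ fun i j hij a b => ?_
  · have := h.hasGaussianLaw.map_fun (ContinuousLinearMap.pi fun i =>
      ContinuousLinearMap.pi fun a => linFormCLM (c i a))
    refine this.congr (Eventually.of_forall fun ω => ?_)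
    exact funext fun i => funext fun a => linFormCLM_apply (c i a) ω
  · rw [h.covariance_linForm, hc i j hij, mul_zero]

/-- Two-sided Gaussian tail bound. -/
lemma measureReal_le_abs_linForm (h : IIDGaussian P X v) {c : τ → ℝ} {B r : ℝ} (hB : 0 < B)
    (hc : v * ∑ t, c t ^ 2 ≤ B) (hr : 0 ≤ r) :
    P.real {ω | r ≤ |linForm X c ω|} ≤ 2 * Real.exp (-r ^ 2 / (2 * B)) := by
  have := h.isProbabilityMeasure
  have key : ∀ d : τ → ℝ, v * ∑ t, d t ^ 2 ≤ B →
      P.real {ω | r ≤ linForm X d ω} ≤ Real.exp (-r ^ 2 / (2 * B)) := by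
    intro d hd
    have hsub : HasSubgaussianMGF (linForm X d) ⟨B, hB.le⟩ P := by
      refine ⟨fun t => ?_, fun t => ?_⟩
      · have := integrable_exp_mul_gaussianReal (μ := 0) (v := (v * ∑ t, d t ^ 2).toNNReal) t
        rw [← h.map_linForm d] at this
        exact this.comp_aemeasurable (h.hasGaussianLaw_linForm d).aemeasurable
      · rw [mgf_gaussianReal (h.map_linForm d)]
        refine Real.exp_le_exp.2 ?_
        rw [Real.coe_toNNReal _
          (mul_nonneg v.coe_nonneg (Finset.sum_nonneg fun _ _ => sq_nonneg _))]
        have := mul_le_mul_of_nonneg_right hd (sq_nonneg t)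
        simp only [zero_mul, zero_add]
        change _ ≤ B * t ^ 2 / 2
        linarith
    exact hsub.measure_ge_le hr
  have hneg : ∀ ω, linForm X (-c) ω = -linForm X c ω := fun ω => by
    simp [linForm]
  have hsplit : {ω | r ≤ |linForm X c ω|} ⊆
      {ω | r ≤ linForm X c ω} ∪ {ω | r ≤ linForm X (-c) ω} := by
    intro ω hω
    simp only [Set.mem_union, Set.mem_ofPred_eq, hneg] at hω ⊢
    exact le_abs.1 hω
  refine (measureReal_mono hsplit).trans ((measureReal_union_le _ _).trans ?_)
  have h1 := key c hc
  have h2 := key (-c) (by simpa using hc)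
  linarith

end IIDGaussian

/-! ### Quadratic functions of Gaussian variables -/

lemma integrable_exp_sq_gaussianReal {w : ℝ≥0} {A : ℝ} (_hA : 0 < A) (hw : (w : ℝ) ≤ A) :
    Integrable (fun x => Real.exp (x ^ 2 / (4 * A))) (gaussianReal 0 w) ∧
      ∫ x, Real.exp (x ^ 2 / (4 * A)) ∂(gaussianReal 0 w) ≤ 2 := by
  rcases eq_or_ne w 0 with rfl | hw0
  · rw [gaussianReal_zero_var]
    refine ⟨integrable_dirac (by simp), ?_⟩
    rw [integral_dirac]; simp
  have hwpos : (0 : ℝ) < w := by positivity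
  have hb : (0 : ℝ) < 1 / (4 * w) := by positivity
  have hpt : ∀ x : ℝ, gaussianPDFReal 0 w x * Real.exp (x ^ 2 / (4 * A)) ≤
      (Real.sqrt (2 * Real.pi * w))⁻¹ * Real.exp (-(1 / (4 * (w : ℝ))) * x ^ 2) := by
    intro x
    rw [gaussianPDFReal, mul_assoc, ← Real.exp_add]
    refine mul_le_mul_of_nonneg_left (Real.exp_le_exp.2 ?_) (by positivity)
    have : x ^ 2 / (4 * A) ≤ x ^ 2 / (4 * w) := by gcongr
    have e : -(1 / (4 * (w : ℝ))) * x ^ 2 = -(x - 0) ^ 2 / (2 * w) + x ^ 2 / (4 * w) := by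
      field_simp
      ring
    rw [e]
    linarith
  have hint : Integrable (fun x : ℝ =>
      (Real.sqrt (2 * Real.pi * w))⁻¹ * Real.exp (-(1 / (4 * (w : ℝ))) * x ^ 2)) :=
    (integrable_exp_neg_mul_sq hb).const_mul _
  have hint' : Integrable (fun x : ℝ => gaussianPDFReal 0 w x * Real.exp (x ^ 2 / (4 * A))) := by
    refine hint.mono' (by fun_prop) (Eventually.of_forall fun x => ?_)
    rw [Real.norm_of_nonneg (mul_nonneg (gaussianPDFReal_nonneg _ _ _) (Real.exp_pos _).le)]
    exact hpt x
  constructor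
  · rw [gaussianReal_of_var_ne_zero _ hw0, gaussianPDF_def]
    rw [integrable_withDensity_iff_integrable_smul' (by fun_prop) (by simp)]
    refine hint'.congr (Eventually.of_forall fun x => ?_)
    simp [ENNReal.toReal_ofReal (gaussianPDFReal_nonneg _ _ _)]
  · rw [integral_gaussianReal_eq_integral_smul hw0]
    simp only [smul_eq_mul]
    refine (integral_mono hint' hint hpt).trans ?_
    rw [integral_const_mul, integral_gaussian, inv_mul_le_iff₀ (by positivity),
      show Real.pi / (1 / (4 * (w : ℝ))) = 2 * (2 * Real.pi * w) by field_simp; ring,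
      Real.sqrt_mul (by norm_num)]
    have h2 : Real.sqrt 2 ≤ 2 := by rw [Real.sqrt_le_left (by norm_num)]; norm_num
    nlinarith [Real.sqrt_nonneg (2 * Real.pi * w)]

lemma integrable_pow_four_gaussianReal {w : ℝ≥0} {A : ℝ} (hA : 0 < A) (hw : (w : ℝ) ≤ A) :
    Integrable (fun x => x ^ 4) (gaussianReal 0 w) ∧
      ∫ x, x ^ 4 ∂(gaussianReal 0 w) ≤ 64 * A ^ 2 := by
  obtain ⟨hi, hle⟩ := integrable_exp_sq_gaussianReal hA hw
  have hpt : ∀ x : ℝ, x ^ 4 ≤ 32 * A ^ 2 * Real.exp (x ^ 2 / (4 * A)) := by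
    intro x
    have h0 : 0 ≤ x ^ 2 / (4 * A) := by positivity
    have h1 := Real.quadratic_le_exp_of_nonneg h0
    have h2 : (x ^ 2 / (4 * A)) ^ 2 / 2 ≤ Real.exp (x ^ 2 / (4 * A)) := by linarith
    have h3 : x ^ 4 = 32 * A ^ 2 * ((x ^ 2 / (4 * A)) ^ 2 / 2) := by
      field_simp
      ring
    rw [h3]
    exact mul_le_mul_of_nonneg_left h2 (by positivity)
  have hi4 : Integrable (fun x : ℝ => x ^ 4) (gaussianReal 0 w) := by
    refine (hi.const_mul (32 * A ^ 2)).mono' (by fun_prop) (Eventually.of_forall fun x => ?_)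
    rw [Real.norm_of_nonneg (by positivity)]
    exact hpt x
  refine ⟨hi4, (integral_mono hi4 (hi.const_mul _) hpt).trans ?_⟩
  rw [integral_const_mul]
  nlinarith [sq_nonneg A]

end Gaussian

/-! ### Gaussian matrices -/

section GaussianMatrix

variable {Ω ι κ : Type*} [MeasurableSpace Ω] {P : Measure Ω}

/-- A conditional bound, given the value of `V`, holds unconditionally when `g` is independent
of `V`. -/
lemma measureReal_le_of_indepFun {α β : Type*} [MeasurableSpace α] [MeasurableSpace β]
    [IsProbabilityMeasure P] {V : Ω → α} {g : Ω → β} (hV : AEMeasurable V P)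
    (hg : AEMeasurable g P) (hind : IndepFun V g P) {T : Set (α × β)} (hT : MeasurableSet T)
    {δ : ℝ} (hδ : 0 ≤ δ) (hle : ∀ x, P.real {ω | (x, g ω) ∈ T} ≤ δ) :
    P.real {ω | (V ω, g ω) ∈ T} ≤ δ := by
  have h1 : P {ω | (V ω, g ω) ∈ T} = (P.map fun ω => (V ω, g ω)) T :=
    (Measure.map_apply_of_aemeasurable (hV.prodMk hg) hT).symm
  have : IsProbabilityMeasure (P.map V) := Measure.isProbabilityMeasure_map hV
  have : IsProbabilityMeasure (P.map g) := Measure.isProbabilityMeasure_map hg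
  rw [(indepFun_iff_map_prod_eq_prod_map_map hV hg).1 hind, Measure.prod_apply hT] at h1
  have h2 : ∀ x, (P.map g) (Prod.mk x ⁻¹' T) ≤ ENNReal.ofReal δ := by
    intro x
    rw [Measure.map_apply_of_aemeasurable hg (measurable_prodMk_left hT)]
    have := hle x
    rw [measureReal_def] at this
    exact (ENNReal.le_ofReal_iff_toReal_le (measure_ne_top _ _) hδ).2 this
  rw [measureReal_def]
  refine ENNReal.toReal_le_of_le_ofReal hδ ?_
  rw [h1]
  refine (lintegral_mono h2).trans ?_
  simp

/-- Markov's inequality for a sum of squares. -/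
lemma measureReal_le_sum_sq_le {α : Type*} [Fintype α] [IsProbabilityMeasure P] {D : α → Ω → ℝ}
    {K r : ℝ} (hr : 0 < r) (hD : ∀ a, Integrable (fun ω => D a ω ^ 2) P)
    (hK : ∀ a, ∫ ω, D a ω ^ 2 ∂P ≤ K) :
    P.real {ω | r ≤ ∑ a, D a ω ^ 2} ≤ Fintype.card α * K / r := by
  have h1 := mul_meas_ge_le_integral_of_nonneg (μ := P) (f := fun ω => ∑ a, D a ω ^ 2)
    (Eventually.of_forall fun ω => Finset.sum_nonneg fun a _ => sq_nonneg _)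
    (integrable_finsetSum _ fun a _ => hD a) r
  rw [integral_finsetSum _ fun a _ => hD a] at h1
  rw [le_div_iff₀ hr, mul_comm]
  refine h1.trans ((Finset.sum_le_sum fun a _ => hK a).trans ?_)
  simp

variable {v : ℝ≥0} {M : Ω → Matrix ι κ ℝ}

lemma IIDGaussian.transpose (h : IIDGaussian P (fun (q : ι × κ) ω => M ω q.1 q.2) v) :
    IIDGaussian P (fun (q : κ × ι) ω => (M ω)ᵀ q.1 q.2) v where
  law q := h.law q.swap
  indep := h.indep.precomp Prod.swap_injective

variable [Fintype ι] [Fintype κ]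

/-- The coefficients of the linear form `M ↦ (M a)_l`. -/
def rowCoef {ι κ : Type*} [DecidableEq ι] (l : ι) (a : κ → ℝ) (q : ι × κ) : ℝ :=
  if q.1 = l then a q.2 else 0

lemma linForm_rowCoef [DecidableEq ι] {Ω : Type*} {M : Ω → Matrix ι κ ℝ} (l : ι) (a : κ → ℝ)
    (ω : Ω) :
    linForm (fun (q : ι × κ) ω => M ω q.1 q.2) (rowCoef l a) ω = (M ω *ᵥ a) l := by
  simp only [linForm, rowCoef, Fintype.sum_prod_type, Matrix.mulVec, dotProduct]
  rw [Finset.sum_eq_single l]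
  · simp [mul_comm]
  · intro b _ hb
    simp [hb]
  · simp

lemma sum_rowCoef_mul_rowCoef [DecidableEq ι] (l l' : ι) (a b : κ → ℝ) :
    ∑ q, rowCoef l a q * rowCoef l' b q = if l = l' then a ⬝ᵥ b else 0 := by
  simp only [rowCoef, Fintype.sum_prod_type, dotProduct]
  rw [Finset.sum_eq_single l]
  · by_cases hl : l = l' <;> simp [hl]
  · intro c _ hc
    simp [hc]
  · simp

lemma sum_rowCoef_sq [DecidableEq ι] (l : ι) (a : κ → ℝ) :
    ∑ q, rowCoef l a q ^ 2 = ∑ i, a i ^ 2 := by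
  have := sum_rowCoef_mul_rowCoef l l a a
  simpa [dotProduct, sq] using this

lemma IIDGaussian.map_mulVec
    (h : IIDGaussian P (fun (q : ι × κ) ω => M ω q.1 q.2) v)
    (a : κ → ℝ) (l : ι) :
    P.map (fun ω => (M ω *ᵥ a) l) = gaussianReal 0 (v * ∑ i, a i ^ 2).toNNReal := by
  classical
  have := h.map_linForm (rowCoef l a)
  rw [sum_rowCoef_sq] at this
  rw [← this]
  congr 1
  exact funext fun ω => (linForm_rowCoef l a ω).symm

lemma IIDGaussian.hasGaussianLaw_mulVec
    (h : IIDGaussian P (fun (q : ι × κ) ω => M ω q.1 q.2) v)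
    (a : κ → ℝ) (l : ι) :
    HasGaussianLaw (fun ω => (M ω *ᵥ a) l) P := by
  classical
  exact (h.hasGaussianLaw_linForm (rowCoef l a)).congr
    (Eventually.of_forall fun ω => linForm_rowCoef l a ω)

lemma IIDGaussian.integral_mulVec_mul_mulVec
    (h : IIDGaussian P (fun (q : ι × κ) ω => M ω q.1 q.2) v)
    (a b : κ → ℝ) (l : ι) :
    ∫ ω, (M ω *ᵥ a) l * (M ω *ᵥ b) l ∂P = v * (a ⬝ᵥ b) := by
  classical
  have := h.isProbabilityMeasure
  have h1 := h.covariance_linForm (rowCoef l a) (rowCoef l b)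
  rw [sum_rowCoef_mul_rowCoef, if_pos rfl, covariance_eq_sub
    (h.hasGaussianLaw_linForm _).memLp_two (h.hasGaussianLaw_linForm _).memLp_two,
    h.integral_linForm, zero_mul, sub_zero] at h1
  rw [← h1]
  refine integral_congr_ae (Eventually.of_forall fun ω => ?_)
  simp only [Pi.mul_apply, linForm_rowCoef]

lemma IIDGaussian.integral_mulVec_pow_four
    (h : IIDGaussian P (fun (q : ι × κ) ω => M ω q.1 q.2) v)
    {a : κ → ℝ} {A : ℝ} (hA : 0 < A)
    (ha : v * ∑ i, a i ^ 2 ≤ A) (l : ι) :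
    Integrable (fun ω => (M ω *ᵥ a) l ^ 4) P ∧ ∫ ω, (M ω *ᵥ a) l ^ 4 ∂P ≤ 64 * A ^ 2 := by
  have hw : (((v * ∑ i, a i ^ 2).toNNReal : ℝ≥0) : ℝ) ≤ A := by
    rwa [Real.coe_toNNReal _ (mul_nonneg v.coe_nonneg (Finset.sum_nonneg fun _ _ => sq_nonneg _))]
  have h1 := integrable_pow_four_gaussianReal hA hw
  have hm := (h.hasGaussianLaw_mulVec a l).aemeasurable
  rw [← h.map_mulVec a l, integral_map hm (by fun_prop)] at h1
  exact ⟨h1.1.comp_aemeasurable hm, h1.2⟩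

/-- The rows of `M` are independent, hence so are functions of `(M a)_l` and `(M b)_l` for
different `l`. -/
lemma IIDGaussian.iIndepFun_mulVec
    (h : IIDGaussian P (fun (q : ι × κ) ω => M ω q.1 q.2) v)
    (a b : κ → ℝ) :
    iIndepFun (fun l ω => ((M ω *ᵥ a) l, (M ω *ᵥ b) l)) P := by
  classical
  have h1 : iIndepFun (fun l ω (t : Bool) => linForm (fun (q : ι × κ) ω => M ω q.1 q.2)
      (rowCoef l (if t then a else b)) ω) P := by
    refine h.iIndepFun_linForm (c := fun l (t : Bool) => rowCoef l (if t then a else b))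
      fun i j hij s t => ?_
    rw [sum_rowCoef_mul_rowCoef, if_neg hij]
  have h2 := h1.comp (fun _ (y : Bool → ℝ) => (y true, y false)) (fun _ => by fun_prop)
  refine h2.congr fun l => Eventually.of_forall fun ω => ?_
  simp [linForm_rowCoef]

/-- The variance of `⟨M a, M b⟩` is at most of order `|ι| v² ‖a‖² ‖b‖²`. -/
lemma IIDGaussian.integral_sq_inner_sub
    (h : IIDGaussian P (fun (q : ι × κ) ω => M ω q.1 q.2) v)
    {a b : κ → ℝ} {A B : ℝ} (hA : 0 < A) (hB : 0 < B)
    (ha : v * ∑ i, a i ^ 2 ≤ A) (hb : v * ∑ i, b i ^ 2 ≤ B) :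
    Integrable (fun ω => ((M ω *ᵥ a) ⬝ᵥ (M ω *ᵥ b) - Fintype.card ι * v * (a ⬝ᵥ b)) ^ 2) P ∧
    ∫ ω, ((M ω *ᵥ a) ⬝ᵥ (M ω *ᵥ b) - Fintype.card ι * v * (a ⬝ᵥ b)) ^ 2 ∂P
      ≤ 64 * Fintype.card ι * (A * B) := by
  have := h.isProbabilityMeasure
  set x : ι → Ω → ℝ := fun l ω => (M ω *ᵥ a) l
  set y : ι → Ω → ℝ := fun l ω => (M ω *ᵥ b) l
  have hx4 := fun l => h.integral_mulVec_pow_four hA ha l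
  have hy4 := fun l => h.integral_mulVec_pow_four hB hb l
  -- AM-GM with weights that balance the two fourth moments
  have hpt : ∀ l ω, (x l ω * y l ω) ^ 2
      ≤ B / (2 * A) * x l ω ^ 4 + A / (2 * B) * y l ω ^ 4 := by
    intro l ω
    have : B / (2 * A) * x l ω ^ 4 + A / (2 * B) * y l ω ^ 4 - (x l ω * y l ω) ^ 2
        = (B * x l ω ^ 2 - A * y l ω ^ 2) ^ 2 / (2 * A * B) := by
      field_simp
      ring
    have : 0 ≤ (B * x l ω ^ 2 - A * y l ω ^ 2) ^ 2 / (2 * A * B) := by positivity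
    linarith
  have hxm := fun l => (h.hasGaussianLaw_mulVec a l).aemeasurable
  have hym := fun l => (h.hasGaussianLaw_mulVec b l).aemeasurable
  have hdom := fun l => ((hx4 l).1.const_mul (B / (2 * A))).add ((hy4 l).1.const_mul (A / (2 * B)))
  have hsq : ∀ l, Integrable (fun ω => (x l ω * y l ω) ^ 2) P := by
    intro l
    refine (hdom l).mono' (((hxm l).mul (hym l)).pow_const 2).aestronglyMeasurable
      (Eventually.of_forall fun ω => ?_)
    rw [Real.norm_of_nonneg (sq_nonneg _)]
    exact hpt l ω
  have hmem : ∀ l, MemLp (fun ω => x l ω * y l ω) 2 P := fun l =>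
    (memLp_two_iff_integrable_sq ((hxm l).mul (hym l)).aestronglyMeasurable).2 (hsq l)
  have hvar : ∀ l, Var[fun ω => x l ω * y l ω; P] ≤ 64 * (A * B) := by
    intro l
    refine (variance_le_expectation_sq ((hxm l).mul (hym l)).aestronglyMeasurable).trans ?_
    refine (integral_mono (hsq l) (hdom l) (hpt l)).trans ?_
    simp only [Pi.add_apply]
    rw [integral_add ((hx4 l).1.const_mul _) ((hy4 l).1.const_mul _), integral_const_mul,
      integral_const_mul]
    have h1 := mul_le_mul_of_nonneg_left (hx4 l).2 (show 0 ≤ B / (2 * A) by positivity)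
    have h2 := mul_le_mul_of_nonneg_left (hy4 l).2 (show 0 ≤ A / (2 * B) by positivity)
    have e1 : B / (2 * A) * (64 * A ^ 2) = 32 * (A * B) := by field_simp; ring
    have e2 : A / (2 * B) * (64 * B ^ 2) = 32 * (A * B) := by field_simp; ring
    linarith
  have hind : iIndepFun (fun l ω => x l ω * y l ω) P :=
    (h.iIndepFun_mulVec a b).comp (fun _ z => z.1 * z.2) (fun _ => by fun_prop)
  have hsum : Var[∑ l, fun ω => x l ω * y l ω; P] = ∑ l, Var[fun ω => x l ω * y l ω; P] :=
    IndepFun.variance_sum (fun l _ => hmem l) fun i _ j _ hij => hind.indepFun hij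
  have hmemS : MemLp (∑ l, fun ω => x l ω * y l ω) 2 P := memLp_finsetSum' _ fun l _ => hmem l
  have hfun : ∀ ω, (∑ l, fun ω => x l ω * y l ω) ω = (M ω *ᵥ a) ⬝ᵥ (M ω *ᵥ b) := fun ω => by
    simp [dotProduct, x, y]
  have hmean : ∫ ω, (∑ l, fun ω => x l ω * y l ω) ω ∂P = Fintype.card ι * v * (a ⬝ᵥ b) := by
    simp only [Finset.sum_apply]
    rw [integral_finsetSum _ fun l _ => (hmem l).integrable (by norm_num)]
    simp only [x, y, h.integral_mulVec_mul_mulVec]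
    simp [mul_assoc]
  have hv := variance_eq_integral hmemS.aestronglyMeasurable.aemeasurable
  rw [hmean] at hv
  simp only [hfun] at hv
  constructor
  · have := (hmemS.sub (memLp_const (Fintype.card ι * v * (a ⬝ᵥ b)))).integrable_sq
    refine this.congr (Eventually.of_forall fun ω => ?_)
    simp only [Pi.sub_apply, hfun]
  · rw [← hv, hsum]
    refine (Finset.sum_le_sum fun l _ => hvar l).trans (le_of_eq ?_)
    simp
    ring

/-- Chi-square upper tail for `‖M a‖²`. -/
lemma IIDGaussian.measureReal_le_sum_sq_mulVec
    (h : IIDGaussian P (fun (q : ι × κ) ω => M ω q.1 q.2) v)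
    {a : κ → ℝ} (ha : v * ∑ i, a i ^ 2 ≤ 1) :
    P.real {ω | 4 * (Fintype.card ι : ℝ) ≤ ∑ l, (M ω *ᵥ a) l ^ 2}
      ≤ Real.exp (-(Fintype.card ι : ℝ) / 4) := by
  have := h.isProbabilityMeasure
  have hxm := fun l => (h.hasGaussianLaw_mulVec a l).aemeasurable
  have hw : (((v * ∑ i, a i ^ 2).toNNReal : ℝ≥0) : ℝ) ≤ 1 := by
    rwa [Real.coe_toNNReal _ (mul_nonneg v.coe_nonneg (Finset.sum_nonneg fun _ _ => sq_nonneg _))]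
  have hexp : ∀ l, Integrable (fun ω => Real.exp (1 / 4 * (M ω *ᵥ a) l ^ 2)) P ∧
      ∫ ω, Real.exp (1 / 4 * (M ω *ᵥ a) l ^ 2) ∂P ≤ 2 := by
    intro l
    have h1 := integrable_exp_sq_gaussianReal one_pos hw
    have e : ∀ x : ℝ, x ^ 2 / (4 * 1) = 1 / 4 * x ^ 2 := fun x => by ring
    simp only [e] at h1
    rw [← h.map_mulVec a l, integral_map (hxm l) (by fun_prop)] at h1
    exact ⟨h1.1.comp_aemeasurable (hxm l), h1.2⟩
  have hind : iIndepFun (fun l ω => (M ω *ᵥ a) l ^ 2) P :=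
    (h.iIndepFun_mulVec a a).comp (fun _ z => z.1 ^ 2) (fun _ => by fun_prop)
  have hmgf := hind.mgf_sum₀ (t := 1 / 4) (fun l => (hxm l).pow_const 2) Finset.univ
  have hint : Integrable (fun ω => Real.exp (1 / 4 * (∑ l, fun ω => (M ω *ᵥ a) l ^ 2) ω)) P := by
    -- the moment generating function would otherwise have the junk value `0`
    by_contra hni
    rw [mgf_undef hni] at hmgf
    exact (Finset.prod_pos fun l _ => mgf_pos (hexp l).1).ne hmgf
  have hch := measure_ge_le_exp_mul_mgf (4 * (Fintype.card ι : ℝ)) (by norm_num) hint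
  have hle : mgf (∑ l, fun ω => (M ω *ᵥ a) l ^ 2) P (1 / 4) ≤ 2 ^ Fintype.card ι := by
    rw [hmgf]
    refine (Finset.prod_le_prod (fun l _ => mgf_nonneg) fun l _ => (hexp l).2).trans ?_
    simp
  have h2 : (2 : ℝ) ≤ Real.exp (3 / 4) := by
    rw [← Real.log_le_iff_le_exp (by norm_num)]
    linarith [Real.log_two_lt_d9]
  have hset : {ω | 4 * (Fintype.card ι : ℝ) ≤ ∑ l, (M ω *ᵥ a) l ^ 2}
      = {ω | 4 * (Fintype.card ι : ℝ) ≤ (∑ l, fun ω => (M ω *ᵥ a) l ^ 2) ω} := by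
    ext ω; simp
  rw [hset]
  refine hch.trans ((mul_le_mul_of_nonneg_left hle (Real.exp_pos _).le).trans ?_)
  refine (mul_le_mul_of_nonneg_left (pow_le_pow_left₀ (by norm_num) h2 _)
    (Real.exp_pos _).le).trans (le_of_eq ?_)
  rw [← Real.exp_nat_mul, ← Real.exp_add]
  congr 1
  ring

/-- Gaussian tail of `⟨w, M a⟩` for a fixed `w`. -/
lemma IIDGaussian.measureReal_le_abs_dotProduct_mulVec
    (h : IIDGaussian P (fun (q : ι × κ) ω => M ω q.1 q.2) v)
    {a : κ → ℝ} {w : ι → ℝ} {B r : ℝ}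
    (hB : 0 < B) (hw : v * ((∑ l, w l ^ 2) * ∑ i, a i ^ 2) ≤ B) (hr : 0 ≤ r) :
    P.real {ω | r ≤ |w ⬝ᵥ (M ω *ᵥ a)|} ≤ 2 * Real.exp (-r ^ 2 / (2 * B)) := by
  have e : ∀ ω, linForm (fun (q : ι × κ) ω => M ω q.1 q.2) (fun q => w q.1 * a q.2) ω
      = w ⬝ᵥ (M ω *ᵥ a) := by
    intro ω
    simp only [linForm, Fintype.sum_prod_type, dotProduct, Matrix.mulVec, Finset.mul_sum]
    exact Finset.sum_congr rfl fun i _ => Finset.sum_congr rfl fun j _ => by ring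
  have h1 := h.measureReal_le_abs_linForm (c := fun q => w q.1 * a q.2) hB ?_ hr
  · simpa only [e] using h1
  · rw [Fintype.sum_prod_type]
    simp only [mul_pow]
    rwa [← Finset.sum_mul_sum]

/-- For orthogonal directions, the images under `M` are independent. -/
lemma IIDGaussian.indepFun_mulVec
    (h : IIDGaussian P (fun (q : ι × κ) ω => M ω q.1 q.2) v)
    {α : Type*} [Fintype α] {c : Matrix κ α ℝ} {a : κ → ℝ}
    (hca : cᵀ *ᵥ a = 0) :
    IndepFun (fun ω (q : ι × α) => (M ω * c) q.1 q.2) (fun ω => M ω *ᵥ a) P := by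
  classical
  have h1 : IndepFun (fun ω (q : ι × α) => linForm (fun (q : ι × κ) ω => M ω q.1 q.2)
      (rowCoef q.1 (c.col q.2)) ω)
      (fun ω l => linForm (fun (q : ι × κ) ω => M ω q.1 q.2) (rowCoef l a) ω) P := by
    refine h.indepFun_linForm (c := fun q : ι × α => rowCoef q.1 (c.col q.2))
      (d := fun l => rowCoef l a) fun q l => ?_
    rw [sum_rowCoef_mul_rowCoef]
    have : c.col q.2 ⬝ᵥ a = 0 := congrFun hca q.2
    rw [this, ite_self]
  simp only [linForm_rowCoef] at h1
  exact h1

end GaussianMatrix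

/-! ### Measurability of the witness -/

section Measurability

variable {α ι κ τ : Type*} [MeasurableSpace α] [Fintype ι]

lemma measurable_mul_apply {A : α → Matrix τ ι ℝ} {B : α → Matrix ι κ ℝ}
    (hA : ∀ i j, Measurable fun x => A x i j) (hB : ∀ i j, Measurable fun x => B x i j)
    (i : τ) (j : κ) : Measurable fun x => (A x * B x) i j := by
  simp only [Matrix.mul_apply]
  exact Finset.measurable_fun_sum _ fun l _ => (hA i l).mul (hB l j)

lemma measurable_mulVec_apply {A : α → Matrix τ ι ℝ} {u : α → ι → ℝ}
    (hA : ∀ i j, Measurable fun x => A x i j) (hu : ∀ i, Measurable fun x => u x i) (i : τ) :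
    Measurable fun x => (A x *ᵥ u x) i := by
  simp only [Matrix.mulVec, dotProduct]
  exact Finset.measurable_fun_sum _ fun l _ => (hA i l).mul (hu l)

lemma measurable_inv_apply [DecidableEq ι] {A : α → Matrix ι ι ℝ}
    (hA : ∀ i j, Measurable fun x => A x i j) (i j : ι) : Measurable fun x => (A x)⁻¹ i j := by
  have hA' : Measurable fun x => (fun i j => A x i j : ι → ι → ℝ) :=
    measurable_pi_iff.2 fun i => measurable_pi_iff.2 fun j => hA i j
  have hdet : Measurable fun M : ι → ι → ℝ => Matrix.det (Matrix.of M) :=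
    (Continuous.matrix_det (by fun_prop)).measurable
  have hadj : Measurable fun M : ι → ι → ℝ => Matrix.adjugate (Matrix.of M) i j :=
    (Continuous.matrix_elem (Continuous.matrix_adjugate (by fun_prop)) i j).measurable
  simp only [Matrix.inv_def, Ring.inverse_eq_inv', Matrix.smul_apply, smul_eq_mul]
  exact (hdet.comp hA').inv.mul (hadj.comp hA')

lemma measurable_normGram_apply (c : ℝ) {M : α → Matrix ι κ ℝ}
    (hM : ∀ i j, Measurable fun x => M x i j) (i j : κ) :
    Measurable fun x => normGram c (M x) i j := by
  simp only [normGram_apply]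
  exact (Finset.measurable_fun_sum _ fun l _ => (hM l i).mul (hM l j)).const_mul _

lemma measurable_residual_apply [Fintype κ] [DecidableEq κ] (c : ℝ) {M : α → Matrix ι κ ℝ}
    {z : α → ι → ℝ}
    (hM : ∀ i j, Measurable fun x => M x i j) (hz : ∀ i, Measurable fun x => z x i) (i : ι) :
    Measurable fun x => residual c (M x) (z x) i := by
  refine (hz i).sub (measurable_mulVec_apply hM (fun j => ?_) i)
  refine measurable_mulVec_apply (measurable_inv_apply (measurable_normGram_apply c hM))
    (fun j => ?_) j
  exact (measurable_mulVec_apply (A := fun x => (M x)ᵀ) (fun a b => hM b a) hz j).const_mul _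

end Measurability

/-! ### The events on which the witness is controlled -/

section Events

/-- The rows of `Φ` are nearly orthonormal: `‖Φ Φᵀ - 1‖_F ≤ 1`. -/
def RowIsometry {m n : ℕ} (Φ : Matrix (Fin m) (Fin n) ℝ) : Prop :=
  ∑ q : Fin m × Fin m, (Φ * Φᵀ - (1 : Matrix (Fin m) (Fin m) ℝ)) q.1 q.2 ^ 2 ≤ 1

/-- The normalized Gram matrix of `Y` is within Frobenius distance `r` of `G`. -/
def GramClose {ι : Type*} [Fintype ι] {m : ℕ} (r : ℝ) (G : Matrix ι ι ℝ)
    (Y : Matrix (Fin m) ι ℝ) : Prop :=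
  ∑ q : ι × ι, (normGram (m : ℝ) Y - G) q.1 q.2 ^ 2 ≤ r ^ 2

variable {m n : ℕ}

lemma RowIsometry.sum_sq_transpose_mulVec_le {Φ : Matrix (Fin m) (Fin n) ℝ} (h : RowIsometry Φ)
    (w : Fin m → ℝ) : ∑ i, (Φᵀ *ᵥ w) i ^ 2 ≤ 2 * ∑ l, w l ^ 2 := by
  have h1 := abs_quadForm_le_of_sum_sq (D := Φ * Φᵀ - 1) zero_le_one
    (by rw [one_pow]; exact h) w
  have h2 : ∑ i, (Φᵀ *ᵥ w) i ^ 2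
      = ∑ l, w l ^ 2 + w ⬝ᵥ ((Φ * Φᵀ - (1 : Matrix (Fin m) (Fin m) ℝ)) *ᵥ w) := by
    rw [Matrix.sub_mulVec, dotProduct_sub, Matrix.one_mulVec, ← Matrix.mulVec_mulVec,
      Matrix.dotProduct_mulVec, ← Matrix.mulVec_transpose]
    simp only [dotProduct, sq]
    ring
  have := le_abs_self (w ⬝ᵥ ((Φ * Φᵀ - (1 : Matrix (Fin m) (Fin m) ℝ)) *ᵥ w))
  linarith

section Coercive

variable {ι : Type*} [Fintype ι] [DecidableEq ι]

lemma coercive_of_infNorm_le {G : Matrix ι ι ℝ} (hG : G.IsSymm) {a : ℝ}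
    (ha : infNorm (G - 1) ≤ a) (x : ι → ℝ) : (1 - a) * ∑ i, x i ^ 2 ≤ x ⬝ᵥ (G *ᵥ x) := by
  have h1 := abs_quadForm_le_of_row_sums (hG.sub Matrix.isSymm_one)
    (fun i => (sum_abs_row_le_infNorm (G - 1) i).trans ha) x
  have h2 : x ⬝ᵥ (G *ᵥ x) = ∑ i, x i ^ 2 + x ⬝ᵥ ((G - 1) *ᵥ x) := by
    rw [Matrix.sub_mulVec, dotProduct_sub, Matrix.one_mulVec]
    simp only [dotProduct, sq]
    ring
  have := neg_abs_le (x ⬝ᵥ ((G - 1) *ᵥ x))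
  linarith

lemma GramClose.coercive {G : Matrix ι ι ℝ} (hG : G.IsSymm) {a r : ℝ} (hr : 0 ≤ r)
    (ha : infNorm (G - 1) ≤ a) (hra : 2 * r ≤ 1 - a) {Y : Matrix (Fin m) ι ℝ}
    (hY : GramClose r G Y) (x : ι → ℝ) :
    (1 - a) / 2 * ∑ i, x i ^ 2 ≤ x ⬝ᵥ (normGram (m : ℝ) Y *ᵥ x) := by
  have h1 := coercive_of_infNorm_le hG ha x
  have h2 := abs_quadForm_le_of_sum_sq hr hY x
  have h3 : x ⬝ᵥ (normGram (m : ℝ) Y *ᵥ x)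
      = x ⬝ᵥ (G *ᵥ x) + x ⬝ᵥ ((normGram (m : ℝ) Y - G) *ᵥ x) := by
    rw [Matrix.sub_mulVec, dotProduct_sub]
    ring
  have h4 := neg_abs_le (x ⬝ᵥ ((normGram (m : ℝ) Y - G) *ᵥ x))
  have h5 : 0 ≤ ∑ i, x i ^ 2 := Finset.sum_nonneg fun _ _ => sq_nonneg _
  have h6 : r * ∑ i, x i ^ 2 ≤ (1 - a) / 2 * ∑ i, x i ^ 2 :=
    mul_le_mul_of_nonneg_right (by linarith) h5
  linarith

/-- Size of `Y A⁻¹ u` for `A = (1/m) Yᵀ Y`. -/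
lemma sum_sq_mulVec_inv_le (hm : 0 < (m : ℝ)) {Y : Matrix (Fin m) ι ℝ} {c : ℝ} (hc : 0 < c)
    (hY : ∀ x, c * ∑ i, x i ^ 2 ≤ x ⬝ᵥ (normGram (m : ℝ) Y *ᵥ x)) (u : ι → ℝ) :
    ∑ l, (Y *ᵥ ((normGram (m : ℝ) Y)⁻¹ *ᵥ u)) l ^ 2 ≤ m * ((∑ i, u i ^ 2) / c) := by
  have hd := mulVec_inv_mulVec (isUnit_det_of_coercive hc hY) u
  have h1 := dotProduct_le_of_coercive hc hY hd
  have h2 := dotProduct_normGram_mulVec (m : ℝ) Y ((normGram (m : ℝ) Y)⁻¹ *ᵥ u)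
    ((normGram (m : ℝ) Y)⁻¹ *ᵥ u)
  rw [hd] at h2
  rw [h2, one_div, inv_mul_le_iff₀ hm] at h1
  refine le_trans (le_of_eq ?_) h1
  simp only [dotProduct, sq]

end Coercive

variable {Ω : Type*} [MeasurableSpace Ω] {P : Measure Ω} {Φ : Ω → Matrix (Fin m) (Fin n) ℝ}

lemma measureReal_not_rowIsometry_le (hn : 0 < n)
    (h : IIDGaussian P (fun (q : Fin m × Fin n) ω => Φ ω q.1 q.2) (1 / (n : ℝ≥0))) :
    P.real {ω | ¬ RowIsometry (Φ ω)} ≤ 64 * (m : ℝ) ^ 2 / n := by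
  have := h.isProbabilityMeasure
  have hn' : (0 : ℝ) < n := by exact_mod_cast hn
  have hv : ((1 / (n : ℝ≥0) : ℝ≥0) : ℝ) = 1 / (n : ℝ) := by push_cast; rfl
  have hunit : ∀ k : Fin m, ((1 / (n : ℝ≥0) : ℝ≥0) : ℝ) *
      ∑ i, (Pi.single k (1 : ℝ) : Fin m → ℝ) i ^ 2
      ≤ 1 / n := by
    intro k
    rw [Finset.sum_eq_single k (fun b _ hb => by simp [hb]) (by simp), hv]
    simp
  have key := fun q : Fin m × Fin m => h.transpose.integral_sq_inner_sub
    (a := Pi.single q.1 1) (b := Pi.single q.2 1) (A := 1 / n) (B := 1 / n) (by positivity)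
    (by positivity) (hunit _) (hunit _)
  have e : ∀ (q : Fin m × Fin m) ω, ((Φ ω)ᵀ *ᵥ (Pi.single q.1 (1 : ℝ) : Fin m → ℝ)) ⬝ᵥ
      ((Φ ω)ᵀ *ᵥ (Pi.single q.2 (1 : ℝ) : Fin m → ℝ))
      - (Fintype.card (Fin n) : ℝ) * ((1 / (n : ℝ≥0) : ℝ≥0) : ℝ) *
        ((Pi.single q.1 (1 : ℝ) : Fin m → ℝ) ⬝ᵥ (Pi.single q.2 (1 : ℝ) : Fin m → ℝ))
      = (Φ ω * (Φ ω)ᵀ - (1 : Matrix (Fin m) (Fin m) ℝ)) q.1 q.2 := by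
    intro q ω
    rw [hv, Fintype.card_fin, mul_one_div_cancel hn'.ne']
    simp [Matrix.mul_apply, dotProduct, Matrix.one_apply, Pi.single_apply, eq_comm]
  simp only [e] at key
  simp only [Fintype.card_fin] at key
  have h1 := measureReal_le_sum_sq_le (P := P) (r := 1) one_pos (fun q => (key q).1)
    (fun q => (key q).2)
  refine (measureReal_mono fun ω hω => ?_).trans (h1.trans (le_of_eq ?_))
  · exact (not_le.1 hω).le
  · rw [Fintype.card_prod, Fintype.card_fin]
    push_cast
    field_simp

variable {ι : Type*} [Fintype ι]

/-- Markov's inequality in Frobenius norm: `E ‖A - G‖_F² ≤ 64 |ι|² / m`. -/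
lemma measureReal_not_gramClose_le (hm : 0 < m)
    (h : IIDGaussian P (fun (q : Fin m × Fin n) ω => Φ ω q.1 q.2) (1 / (n : ℝ≥0)))
    {Y : Matrix (Fin n) ι ℝ} (hY : ∀ j, ∑ i, Y i j ^ 2 = (n : ℝ)) (hn : 0 < n) {r : ℝ}
    (hr : 0 < r) :
    P.real {ω | ¬ GramClose r (normGram (n : ℝ) Y) (Φ ω * Y)}
      ≤ 64 * (Fintype.card ι : ℝ) ^ 2 / (m * r ^ 2) := by
  have := h.isProbabilityMeasure
  have hn' : (0 : ℝ) < n := by exact_mod_cast hn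
  have hm' : (0 : ℝ) < m := by exact_mod_cast hm
  have hv : ((1 / (n : ℝ≥0) : ℝ≥0) : ℝ) = 1 / (n : ℝ) := by push_cast; rfl
  have hcol : ∀ j, ((1 / (n : ℝ≥0) : ℝ≥0) : ℝ) * ∑ i, Y.col j i ^ 2 ≤ 1 := fun j => by
    simp only [Matrix.col_apply]
    rw [hv, hY, one_div_mul_cancel hn'.ne']
  have key := fun q : ι × ι => h.integral_sq_inner_sub
    (a := Y.col q.1) (b := Y.col q.2) one_pos one_pos (hcol _) (hcol _)
  have e : ∀ (q : ι × ι) ω, (normGram (m : ℝ) (Φ ω * Y) - normGram (n : ℝ) Y) q.1 q.2 ^ 2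
      = 1 / (m : ℝ) ^ 2 * ((Φ ω *ᵥ Y.col q.1) ⬝ᵥ (Φ ω *ᵥ Y.col q.2) - (Fintype.card (Fin m) : ℝ) *
        ((1 / (n : ℝ≥0) : ℝ≥0) : ℝ) * (Y.col q.1 ⬝ᵥ Y.col q.2)) ^ 2 := by
    intro q ω
    have e1 : (Φ ω *ᵥ Y.col q.1) ⬝ᵥ (Φ ω *ᵥ Y.col q.2)
        = ∑ l, (Φ ω * Y) l q.1 * (Φ ω * Y) l q.2 := rfl
    have e2 : Y.col q.1 ⬝ᵥ Y.col q.2 = ∑ l, Y l q.1 * Y l q.2 := rfl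
    rw [Matrix.sub_apply, normGram_apply, normGram_apply, hv, Fintype.card_fin, e1, e2]
    field_simp
  have h1 := measureReal_le_sum_sq_le (P := P)
    (D := fun (q : ι × ι) ω => (normGram (m : ℝ) (Φ ω * Y) - normGram (n : ℝ) Y) q.1 q.2)
    (K := 64 / m) (r := r ^ 2) (by positivity)
    (fun q => by simp only [e]; exact (key q).1.const_mul _)
    (fun q => by
      simp only [e]
      rw [integral_const_mul]
      refine (mul_le_mul_of_nonneg_left (key q).2 (by positivity)).trans (le_of_eq ?_)
      rw [Fintype.card_fin]
      field_simp)
  refine (measureReal_mono fun ω hω => ?_).trans (h1.trans (le_of_eq ?_))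
  · exact (not_le.1 hω).le
  · rw [Fintype.card_prod]
    push_cast
    field_simp

/-- For a fixed `u`, Markov's inequality for `‖(A - G) u‖₂²`, whose mean involves the `G`-norm
of `u` only. -/
lemma measureReal_gram_mulVec_le (hm : 0 < m)
    (h : IIDGaussian P (fun (q : Fin m × Fin n) ω => Φ ω q.1 q.2) (1 / (n : ℝ≥0)))
    {Y : Matrix (Fin n) ι ℝ} (hY : ∀ j, ∑ i, Y i j ^ 2 = (n : ℝ)) (hn : 0 < n) {u : ι → ℝ}
    {B : ℝ} (hB : 0 < B) (hu : u ⬝ᵥ (normGram (n : ℝ) Y *ᵥ u) ≤ B) :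
    P.real {ω | 1 ≤ ∑ i, ((normGram (m : ℝ) (Φ ω * Y) - normGram (n : ℝ) Y) *ᵥ u) i ^ 2}
      ≤ 64 * (Fintype.card ι : ℝ) * B / m := by
  have := h.isProbabilityMeasure
  have hn' : (0 : ℝ) < n := by exact_mod_cast hn
  have hm' : (0 : ℝ) < m := by exact_mod_cast hm
  have hv : ((1 / (n : ℝ≥0) : ℝ≥0) : ℝ) = 1 / (n : ℝ) := by push_cast; rfl
  have hcol : ∀ j, ((1 / (n : ℝ≥0) : ℝ≥0) : ℝ) * ∑ i, Y.col j i ^ 2 ≤ 1 := fun j => by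
    simp only [Matrix.col_apply]
    rw [hv, hY, one_div_mul_cancel hn'.ne']
  have hYu : ((1 / (n : ℝ≥0) : ℝ≥0) : ℝ) * ∑ i, (Y *ᵥ u) i ^ 2 ≤ B := by
    rw [dotProduct_normGram_mulVec] at hu
    rw [hv]
    refine le_trans (le_of_eq ?_) hu
    simp only [dotProduct, sq]
  have key := fun i : ι => h.integral_sq_inner_sub
    (a := Y.col i) (b := Y *ᵥ u) one_pos hB (hcol _) hYu
  have e : ∀ (i : ι) ω, ((normGram (m : ℝ) (Φ ω * Y) - normGram (n : ℝ) Y) *ᵥ u) i ^ 2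
      = 1 / (m : ℝ) ^ 2 * ((Φ ω *ᵥ Y.col i) ⬝ᵥ (Φ ω *ᵥ (Y *ᵥ u)) - (Fintype.card (Fin m) : ℝ) *
        ((1 / (n : ℝ≥0) : ℝ≥0) : ℝ) * (Y.col i ⬝ᵥ (Y *ᵥ u))) ^ 2 := by
    intro i ω
    have e1 : (normGram (m : ℝ) (Φ ω * Y) *ᵥ u) i
        = 1 / (m : ℝ) * ((Φ ω *ᵥ Y.col i) ⬝ᵥ (Φ ω *ᵥ (Y *ᵥ u))) := by
      rw [normGram_mulVec, Matrix.mulVec_mulVec u (Φ ω) Y]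
      rfl
    have e2 : (normGram (n : ℝ) Y *ᵥ u) i = 1 / (n : ℝ) * (Y.col i ⬝ᵥ (Y *ᵥ u)) := by
      rw [normGram_mulVec]
      rfl
    rw [Matrix.sub_mulVec, Pi.sub_apply, e1, e2, hv, Fintype.card_fin]
    field_simp
  have h1 := measureReal_le_sum_sq_le (P := P)
    (D := fun (i : ι) ω => ((normGram (m : ℝ) (Φ ω * Y) - normGram (n : ℝ) Y) *ᵥ u) i)
    (K := 64 * B / m) (r := 1) one_pos
    (fun q => by simp only [e]; exact (key q).1.const_mul _)
    (fun q => by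
      simp only [e]
      rw [integral_const_mul]
      refine (mul_le_mul_of_nonneg_left (key q).2 (by positivity)).trans (le_of_eq ?_)
      rw [Fintype.card_fin]
      field_simp)
  refine h1.trans (le_of_eq ?_)
  ring

end Events

/-! ### Conditional Gaussian tails -/

section Conditional

variable {Ω : Type*} [MeasurableSpace Ω] {P : Measure Ω} {m n : ℕ}
  {Φ : Ω → Matrix (Fin m) (Fin n) ℝ} {ε : Ω → Fin n → ℝ} {σ : ℝ≥0}

lemma GaussianModel.iidGaussian_matrix (h : GaussianModel P Φ ε σ) :
    IIDGaussian P (fun (q : Fin m × Fin n) ω => Φ ω q.1 q.2) (1 / (n : ℝ≥0)) where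
  law q := h.law_Φ q.1 q.2
  indep := h.indep.precomp (g := Sum.inl) Sum.inl_injective

lemma GaussianModel.iidGaussian_noise (h : GaussianModel P Φ ε σ) :
    IIDGaussian P (fun i ω => ε ω i) (σ ^ 2) where
  law i := h.law_ε i
  indep := h.indep.precomp (g := Sum.inr) Sum.inr_injective

lemma GaussianModel.indepFun (h : GaussianModel P Φ ε σ) :
    IndepFun (fun ω (q : Fin m × Fin n) => Φ ω q.1 q.2) ε P := by
  classical
  set S : Finset ((Fin m × Fin n) ⊕ Fin n) := Finset.univ.image Sum.inl
  set T : Finset ((Fin m × Fin n) ⊕ Fin n) := Finset.univ.image Sum.inr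
  have hST : Disjoint S T := by
    rw [Finset.disjoint_left]
    intro x hx hx'
    simp only [S, T, Finset.mem_image, Finset.mem_univ, true_and] at hx hx'
    obtain ⟨a, rfl⟩ := hx
    obtain ⟨b, hb⟩ := hx'
    cases hb
  have h1 := h.indep.indepFun_finset₀ S T hST fun t => by
    rcases t with q | i
    · exact (h.law_Φ q.1 q.2).aemeasurable
    · exact (h.law_ε i).aemeasurable
  exact h1.comp
    (φ := fun (y : S → ℝ) (q : Fin m × Fin n) =>
      y ⟨Sum.inl q, Finset.mem_image_of_mem _ (Finset.mem_univ q)⟩)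
    (ψ := fun (y : T → ℝ) (i : Fin n) =>
      y ⟨Sum.inr i, Finset.mem_image_of_mem _ (Finset.mem_univ i)⟩)
    (by fun_prop) (by fun_prop)

lemma IIDGaussian.aemeasurable_pi {τ : Type*} [Fintype τ] {X : τ → Ω → ℝ} {v : ℝ≥0}
    (h : IIDGaussian P X v) : AEMeasurable (fun ω t => X t ω) P :=
  aemeasurable_pi_lambda _ fun t => (h.law t).aemeasurable

/-- Gaussian tail of `⟨f(V), g⟩`, conditionally on an independent `V`. -/
lemma measureReal_le_abs_dotProduct_of_indepFun {α κ : Type*} [MeasurableSpace α] [Fintype κ]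
    [IsProbabilityMeasure P] {V : Ω → α} {g : Ω → κ → ℝ} (hV : AEMeasurable V P)
    (hg : AEMeasurable g P) (hind : IndepFun V g P) {E : Set α} (hE : MeasurableSet E)
    {f : α → κ → ℝ} (hf : ∀ i, Measurable fun x => f x i) {B r : ℝ}
    (htail : ∀ x ∈ E, P.real {ω | r ≤ |f x ⬝ᵥ g ω|} ≤ 2 * Real.exp (-r ^ 2 / (2 * B))) :
    P.real {ω | V ω ∈ E ∧ r ≤ |f (V ω) ⬝ᵥ g ω|} ≤ 2 * Real.exp (-r ^ 2 / (2 * B)) := by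
  have hδ : 0 ≤ 2 * Real.exp (-r ^ 2 / (2 * B)) := by positivity
  have hfm : Measurable fun z : α × (κ → ℝ) => f z.1 ⬝ᵥ z.2 := by
    simp only [dotProduct]
    exact Finset.measurable_fun_sum _ fun i _ =>
      ((hf i).comp measurable_fst).mul ((measurable_pi_apply i).comp measurable_snd)
  have hT : MeasurableSet {z : α × (κ → ℝ) | z.1 ∈ E ∧ r ≤ |f z.1 ⬝ᵥ z.2|} :=
    (measurable_fst hE).inter (measurableSet_le measurable_const hfm.abs)
  refine measureReal_le_of_indepFun hV hg hind hT hδ fun x => ?_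
  by_cases hx : x ∈ E
  · simpa [hx] using htail x hx
  · simpa [hx] using hδ

lemma measurableSet_rowIsometry :
    MeasurableSet {x : Fin m × Fin n → ℝ |
      RowIsometry (Matrix.of fun i j => x (i, j) : Matrix (Fin m) (Fin n) ℝ)} := by
  refine measurableSet_le (Finset.measurable_fun_sum _ fun q _ => ?_) measurable_const
  refine Measurable.pow_const ?_ 2
  simp only [Matrix.sub_apply]
  refine Measurable.sub_const (measurable_mul_apply (fun i j => ?_) (fun i j => ?_) _ _) _
  · exact measurable_pi_apply (i, j)
  · exact measurable_pi_apply (j, i)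

lemma measurableSet_gramClose {α ι : Type*} [MeasurableSpace α] [Fintype ι] (r : ℝ)
    (G : Matrix ι ι ℝ) {Y : α → Matrix (Fin m) ι ℝ} (hY : ∀ i j, Measurable fun x => Y x i j) :
    MeasurableSet {x | GramClose r G (Y x)} := by
  refine measurableSet_le (Finset.measurable_fun_sum _ fun q _ => ?_) measurable_const
  exact ((measurable_normGram_apply _ hY _ _).sub_const _).pow_const 2

variable {ι : Type*}

lemma measurable_of_mul_apply (Y : Matrix (Fin n) ι ℝ) (i : Fin m) (j : ι) :
    Measurable fun x : Fin m × Fin n → ℝ =>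
      ((Matrix.of fun i j => x (i, j) : Matrix (Fin m) (Fin n) ℝ) * Y) i j :=
  measurable_mul_apply (B := fun _ => Y) (fun i j => measurable_pi_apply (i, j))
    (fun _ _ => measurable_const) i j

variable [Fintype ι] [DecidableEq ι]

/-- The combination `Y A⁻¹ u` of the columns of `Y`, where `A = (1/m) Yᵀ Y`. Its inner product
with `z` is `m` times the `u`-combination of the regression coefficients of `z` on `Y`. -/
noncomputable def dualVec (Y : Matrix (Fin m) ι ℝ) (u : ι → ℝ) : Fin m → ℝ :=
  Y *ᵥ ((normGram (m : ℝ) Y)⁻¹ *ᵥ u)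

lemma measurable_dualVec_apply {α : Type*} [MeasurableSpace α] {Y : α → Matrix (Fin m) ι ℝ}
    (hY : ∀ i j, Measurable fun x => Y x i j) (u : ι → ℝ) (i : Fin m) :
    Measurable fun x => dualVec (Y x) u i :=
  measurable_mulVec_apply (u := fun x => (normGram (m : ℝ) (Y x))⁻¹ *ᵥ u) hY
    (fun j => measurable_mulVec_apply (A := fun x => (normGram (m : ℝ) (Y x))⁻¹) (u := fun _ => u)
      (fun a b => measurable_inv_apply (measurable_normGram_apply _ hY) a b)
      (fun _ => measurable_const) j) i

/-- If `R` is orthogonal to the columns of `Y`, then `Φ R` is independent of `Φ Y`. -/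
lemma measureReal_le_abs_inner_image_residual (hm : 0 < (m : ℝ)) (hn : 0 < (n : ℝ))
    (h : IIDGaussian P (fun (q : Fin m × Fin n) ω => Φ ω q.1 q.2) (1 / (n : ℝ≥0)))
    {Y : Matrix (Fin n) ι ℝ} {R : Fin n → ℝ} (hR : Yᵀ *ᵥ R = 0) (hRn : ∑ i, R i ^ 2 ≤ n)
    {G : Matrix ι ι ℝ} {c r B t : ℝ} (hc : 0 < c)
    (hcoer : ∀ Y' : Matrix (Fin m) ι ℝ, GramClose r G Y' →
      ∀ x, c * ∑ i, x i ^ 2 ≤ x ⬝ᵥ (normGram (m : ℝ) Y' *ᵥ x))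
    {u : ι → ℝ} (hB : 0 < B) (hu : m * ((∑ i, u i ^ 2) / c) ≤ B) (ht : 0 ≤ t) :
    P.real {ω | GramClose r G (Φ ω * Y) ∧
      t ≤ |dualVec (Φ ω * Y) u ⬝ᵥ (Φ ω *ᵥ R)|} ≤ 2 * Real.exp (-t ^ 2 / (2 * B)) := by
  have := h.isProbabilityMeasure
  have hYm : ∀ i j, Measurable fun x : Fin m × ι → ℝ =>
      (Matrix.of fun i j => x (i, j) : Matrix (Fin m) ι ℝ) i j :=
    fun i j => measurable_pi_apply (i, j)
  have hV : AEMeasurable (fun ω (q : Fin m × ι) => (Φ ω * Y) q.1 q.2) P :=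
    aemeasurable_pi_lambda _ fun q => (h.hasGaussianLaw_mulVec (Y.col q.2) q.1).aemeasurable
  have hg : AEMeasurable (fun ω => Φ ω *ᵥ R) P :=
    aemeasurable_pi_lambda _ fun l => (h.hasGaussianLaw_mulVec R l).aemeasurable
  have hv : ((1 / (n : ℝ≥0) : ℝ≥0) : ℝ) = 1 / (n : ℝ) := by push_cast; rfl
  have htail : ∀ Y' : Matrix (Fin m) ι ℝ, GramClose r G Y' →
      P.real {ω | t ≤ |dualVec Y' u ⬝ᵥ (Φ ω *ᵥ R)|} ≤ 2 * Real.exp (-t ^ 2 / (2 * B)) := by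
    intro Y' hY'
    refine h.measureReal_le_abs_dotProduct_mulVec hB ?_ ht
    refine le_trans ?_ ((sum_sq_mulVec_inv_le hm hc (hcoer _ hY') u).trans hu)
    have h0 : 0 ≤ ∑ l, dualVec Y' u l ^ 2 := Finset.sum_nonneg fun _ _ => sq_nonneg _
    rw [hv, one_div, inv_mul_le_iff₀ hn, mul_comm (n : ℝ)]
    exact mul_le_mul_of_nonneg_left hRn h0
  have key := measureReal_le_abs_dotProduct_of_indepFun hV hg (h.indepFun_mulVec hR)
    (measurableSet_gramClose r G hYm) (measurable_dualVec_apply hYm u)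
    (fun x hx => htail _ hx)
  exact key

/-- Tail of `⟨w(Φ), Φ ε⟩`, conditionally on `Φ` with nearly orthonormal rows. -/
lemma GaussianModel.measureReal_le_abs_noise (h : GaussianModel P Φ ε σ)
    {E : Set (Fin m × Fin n → ℝ)} (hE : MeasurableSet E)
    (hiso : ∀ x ∈ E, RowIsometry (Matrix.of fun i j => x (i, j) : Matrix (Fin m) (Fin n) ℝ))
    {w : (Fin m × Fin n → ℝ) → Fin m → ℝ} (hw : ∀ i, Measurable fun x => w x i)
    {C r : ℝ} (hC : 0 < C) (hwC : ∀ x ∈ E, ∑ l, w x l ^ 2 ≤ C) (hr : 0 ≤ r) :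
    P.real {ω | (fun q : Fin m × Fin n => Φ ω q.1 q.2) ∈ E ∧
      r ≤ |w (fun q => Φ ω q.1 q.2) ⬝ᵥ (Φ ω *ᵥ ε ω)|}
      ≤ 2 * Real.exp (-r ^ 2 / (2 * (2 * C * (σ ^ 2 + 1)))) := by
  have := h.iidGaussian_noise.isProbabilityMeasure
  have hB : 0 < 2 * C * ((σ : ℝ) ^ 2 + 1) := by positivity
  have e : ∀ ω, w (fun q => Φ ω q.1 q.2) ⬝ᵥ (Φ ω *ᵥ ε ω)
      = ((Φ ω)ᵀ *ᵥ w (fun q => Φ ω q.1 q.2)) ⬝ᵥ ε ω := by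
    intro ω
    rw [Matrix.dotProduct_mulVec, ← Matrix.mulVec_transpose]
  simp only [e]
  refine measureReal_le_abs_dotProduct_of_indepFun
    (V := fun ω (q : Fin m × Fin n) => Φ ω q.1 q.2) (g := ε)
    h.iidGaussian_matrix.aemeasurable_pi h.iidGaussian_noise.aemeasurable_pi h.indepFun hE
    (f := fun x => (Matrix.of fun i j => x (i, j) : Matrix (Fin m) (Fin n) ℝ)ᵀ *ᵥ w x)
    (fun i => measurable_mulVec_apply (fun a b => measurable_pi_apply (b, a)) hw i)
    fun x hx => ?_
  refine h.iidGaussian_noise.measureReal_le_abs_linForm hB ?_ hr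
  have h1 := (hiso x hx).sum_sq_transpose_mulVec_le (w x)
  have h2 := hwC x hx
  have h3 : ∑ i, ((Matrix.of fun i j => x (i, j) : Matrix (Fin m) (Fin n) ℝ)ᵀ *ᵥ w x) i ^ 2
      ≤ 2 * C := by linarith
  push_cast
  have h4 := mul_le_mul_of_nonneg_left h3 (sq_nonneg (σ : ℝ))
  linarith

end Conditional

/-! ### Sign recovery with explicit probability -/

section FiniteSample

variable {m n p : ℕ}

lemma regCoef_apply {ι : Type*} [Fintype ι] [DecidableEq ι] (Y : Matrix (Fin m) ι ℝ)
    (w : Fin m → ℝ) (i : ι) :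
    regCoef (m : ℝ) Y w i = 1 / (m : ℝ) * (dualVec Y (Pi.single i 1) ⬝ᵥ w) := by
  have hs : ((normGram (m : ℝ) Y)⁻¹)ᵀ = (normGram (m : ℝ) Y)⁻¹ := by
    rw [Matrix.transpose_nonsing_inv, normGram_isSymm]
  rw [dualVec, ← Matrix.vecMul_transpose, ← Matrix.dotProduct_mulVec, ← Matrix.vecMul_transpose,
    hs, ← Matrix.dotProduct_mulVec, single_one_dotProduct, regCoef, Matrix.mulVec_smul]
  rfl

lemma abs_le_of_sum_sq_le {ι : Type*} [Fintype ι] {x : ι → ℝ} {r : ℝ} (hr : 0 ≤ r)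
    (h : ∑ i, x i ^ 2 ≤ r ^ 2) (i : ι) : |x i| ≤ r := by
  refine abs_le_of_sq_le_sq ?_ hr
  exact (Finset.single_le_sum (f := fun i => x i ^ 2) (fun _ _ => sq_nonneg _)
    (Finset.mem_univ i)).trans h

lemma minCoeff_le (β : Fin p → ℝ) (i : {j // j ∈ supp β}) : minCoeff β ≤ |β i| :=
  ciInf_le (f := fun j : {j // j ∈ supp β} => |β j|) (Set.finite_range _).bddBelow i

lemma minCoeff_pos {β : Fin p → ℝ} (h : (supp β).Nonempty) : 0 < minCoeff β := by
  have : Nonempty {j // j ∈ supp β} := h.to_subtype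
  obtain ⟨i, hi⟩ := exists_eq_ciInf_of_finite (f := fun j : {j // j ∈ supp β} => |β j|)
  have hne : β i ≠ 0 := by simpa [supp] using i.2
  rw [minCoeff, ← hi]
  exact abs_pos.2 hne

lemma abs_signOn_le (β : Fin p → ℝ) (S : Finset (Fin p)) (i : {j // j ∈ S}) :
    |signOn β S i| ≤ 1 := by
  rcases lt_trichotomy (β i) 0 with h | h | h <;> simp [signOn, h]

lemma sum_signOn_sq (β : Fin p → ℝ) :
    ∑ i, signOn β (supp β) i ^ 2 = ((supp β).card : ℝ) := by
  simp [signOn_sq]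

/-- The regression coefficients of an irrelevant column on the relevant ones have `ℓ₁`-norm at
most `1 - η / (1 - a)`, where `a = ‖G - 1‖_∞`. -/
lemma sum_abs_regCoef_le {X : Matrix (Fin n) (Fin p) ℝ} {S : Finset (Fin p)} {η : ℝ}
    (hinc : Incoherent X S η) (ha : infNorm (gram X S - 1) < 1)
    (hdet : IsUnit (gram X S).det) {j : Fin p} (hj : j ∉ S) :
    ∑ i, |regCoef (n : ℝ) (cols X S) (X.col j) i| ≤ 1 - η / (1 - infNorm (gram X S - 1)) := by
  set a := infNorm (gram X S - 1) with hadef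
  have h1a : 0 < 1 - a := by linarith
  have h1 := sum_abs_le_of_mulVec_eq (normGram_isSymm (n : ℝ) (cols X S)) ha
    (fun i => sum_abs_row_le_infNorm _ i)
    (mulVec_inv_mulVec hdet ((1 / (n : ℝ)) • ((cols X S)ᵀ *ᵥ X.col j)))
  have h2 : ∑ i, |((1 / (n : ℝ)) • ((cols X S)ᵀ *ᵥ X.col j)) i|
      ≤ infNorm ((1 / (n : ℝ)) • ((cols X Sᶜ)ᵀ * cols X S)) := by
    refine le_trans (le_of_eq ?_) (sum_abs_row_le_infNorm _ ⟨j, Finset.mem_compl.2 hj⟩)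
    refine Finset.sum_congr rfl fun i _ => ?_
    congr 1
    simp only [Pi.smul_apply, Matrix.smul_apply, Matrix.mulVec, Matrix.mul_apply, dotProduct]
    congr 1
    exact Finset.sum_congr rfl fun l _ => mul_comm _ _
  have h3 := hinc.2.2.2
  refine h1.trans ?_
  rw [div_le_iff₀ h1a, sub_mul, div_mul_cancel₀ _ h1a.ne']
  linarith

lemma half_le_infNorm_gram_inv {X : Matrix (Fin n) (Fin p) ℝ} {S : Finset (Fin p)}
    (hS : S.Nonempty) (ha : infNorm (gram X S - 1) < 1) : 1 / 2 ≤ infNorm (gram X S)⁻¹ := by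
  have hne : Nonempty {j // j ∈ S} := hS.to_subtype
  refine half_le_infNorm_inv (isUnit_det_of_coercive (sub_pos.2 ha)
    (coercive_of_infNorm_le (normGram_isSymm _ _) le_rfl)) fun i j => ?_
  have h1 : |(gram X S - 1) i j| ≤ infNorm (gram X S - 1) :=
    (Finset.single_le_sum (f := fun j => |(gram X S - 1) i j|) (fun _ _ => abs_nonneg _)
      (Finset.mem_univ j)).trans (sum_abs_row_le_infNorm (gram X S - 1) i)
  have h2 : |(1 : Matrix {j // j ∈ S} {j // j ∈ S} ℝ) i j| ≤ 1 := by
    rw [Matrix.one_apply]; split_ifs <;> simp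
  have h3 : gram X S i j
      = (gram X S - 1) i j + (1 : Matrix {j // j ∈ S} {j // j ∈ S} ℝ) i j := by
    rw [Matrix.sub_apply]; ring
  rw [h3]
  refine (abs_add_le _ _).trans ?_
  linarith

/-- On the event that the compressed Gram matrix, the images of the regression residuals, and the
projected noise are controlled, the lasso recovers all signs. -/
lemma compressedLasso_sameSigns (hm : 0 < (m : ℝ))
    {X : Matrix (Fin n) (Fin p) ℝ} {β : Fin p → ℝ} {η lam c : ℝ}
    (hinc : Incoherent X (supp β) η)
    (hc : 0 < c) (hac : infNorm (gram X (supp β) - 1) ≤ 1 - c) (hlam : 0 < lam)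
    (hbias : lam * ((1 + 4 / c) * infNorm (gram X (supp β))⁻¹) < minCoeff β / 2)
    {Φ : Matrix (Fin m) (Fin n) ℝ} {ε : Fin n → ℝ}
    (hgram : GramClose (η / 2) (gram X (supp β)) (Φ * cols X (supp β)))
    (hsgn : ∑ i, ((normGram (m : ℝ) (Φ * cols X (supp β)) - gram X (supp β)) *ᵥ
      ((gram X (supp β))⁻¹ *ᵥ signOn β (supp β))) i ^ 2 ≤ 1)
    (hres : ∀ j ∉ supp β, |dualVec (Φ * cols X (supp β)) (signOn β (supp β)) ⬝ᵥ
      (Φ *ᵥ residual n (cols X (supp β)) (X.col j))|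
        < m * (η / (1 - infNorm (gram X (supp β) - 1)) / 2))
    (hnoise : ∀ j ∉ supp β, |residual m (Φ * cols X (supp β)) (Φ *ᵥ X.col j) ⬝ᵥ (Φ *ᵥ ε)|
        < m * (lam * η / 2))
    (hnoiseS : ∀ i, |dualVec (Φ * cols X (supp β)) (Pi.single i 1) ⬝ᵥ (Φ *ᵥ ε)|
        < m * (minCoeff β / 2)) :
    (compressedLasso Φ X β ε lam).Nonempty ∧
      ∀ b ∈ compressedLasso Φ X β ε lam, SameSigns b β ∧ supp b = supp β := by
  set S := supp β with hS
  set G := gram X S with hG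
  set a := infNorm (G - 1) with ha
  set Y := Φ * cols X S with hY
  set N := infNorm G⁻¹ with hN
  have hGsymm : G.IsSymm := normGram_isSymm _ _
  have h1a : 0 < 1 - a := by linarith
  have hη : 0 < η := hinc.2.1
  have hηa : η ≤ 1 - a := by
    have := hinc.2.2.2
    have h0 := infNorm_nonneg ((1 / (n : ℝ)) • ((cols X Sᶜ)ᵀ * cols X S))
    linarith
  have hGcoer := coercive_of_infNorm_le hGsymm (le_refl a)
  have hGdet : IsUnit G.det := isUnit_det_of_coercive h1a hGcoer
  have hκ : 0 < (1 - a) / 2 := by positivity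
  have hAcoer := hgram.coercive hGsymm (by positivity) (le_refl a) (by linarith)
  have hAdet := isUnit_det_of_coercive hκ hAcoer
  have hNhalf : 1 / 2 ≤ N := half_le_infNorm_gram_inv hinc.1 (by linarith)
  -- the bias `A⁻¹ sgn β` is compared with `G⁻¹ sgn β` in the Euclidean norm
  have hd2 : ∀ i, |((normGram (m : ℝ) Y)⁻¹ *ᵥ signOn β S) i| ≤ (1 + 4 / c) * N := by
    intro i
    set v := G⁻¹ *ᵥ signOn β S with hv
    set d2 := (normGram (m : ℝ) Y)⁻¹ *ᵥ signOn β S with hd2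
    have e1 : normGram (m : ℝ) Y *ᵥ (v - d2) = (normGram (m : ℝ) Y - G) *ᵥ v := by
      rw [Matrix.mulVec_sub, hd2, mulVec_inv_mulVec hAdet, Matrix.sub_mulVec, hv,
        mulVec_inv_mulVec hGdet]
    have h1 := sum_sq_le_of_coercive hκ hAcoer e1
    have h2 : ∑ i, (v - d2) i ^ 2 ≤ (2 / c) ^ 2 := by
      refine h1.trans ?_
      have e2 : (2 / c) ^ 2 * ((1 - a) / 2) ^ 2 = ((1 - a) / c) ^ 2 := by field_simp
      have h3 : 1 ≤ (1 - a) / c := by rw [le_div_iff₀ hc]; linarith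
      rw [div_le_iff₀ (by positivity), e2]
      exact hsgn.trans (one_le_pow₀ h3)
    have h3 := abs_le_of_sum_sq_le (by positivity) h2 i
    have h4 : |v i| ≤ N := by
      refine le_trans ?_ (sum_abs_row_le_infNorm G⁻¹ i)
      simp only [hv, Matrix.mulVec, dotProduct]
      refine (Finset.abs_sum_le_sum_abs _ _).trans (Finset.sum_le_sum fun j _ => ?_)
      rw [abs_mul]
      exact mul_le_of_le_one_right (abs_nonneg _) (abs_signOn_le β S j)
    have h5 : |d2 i| ≤ |v i| + |(v - d2) i| := by
      have : d2 i = v i - (v - d2) i := by simp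
      rw [this]
      exact abs_sub _ _
    have h6 : 2 / c ≤ 4 / c * N := by
      have : 4 / c * (1 / 2) ≤ 4 / c * N := mul_le_mul_of_nonneg_left hNhalf (by positivity)
      have e : 4 / c * (1 / 2) = 2 / c := by ring
      linarith
    linarith
  have hW : Φ *ᵥ (X *ᵥ β + ε) = (Φ * X) *ᵥ β + Φ *ᵥ ε := by
    rw [Matrix.mulVec_add, Matrix.mulVec_mulVec]
  rw [compressedLasso, hW]
  refine lassoSolutions_sameSigns hm hlam hAdet ?_ ?_
  · intro i
    have h1 : |regCoef m Y (Φ *ᵥ ε) i| < minCoeff β / 2 := by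
      rw [regCoef_apply, abs_mul, abs_of_pos (by positivity), one_div, inv_mul_lt_iff₀ hm]
      exact hnoiseS i
    have h2 := mul_le_mul_of_nonneg_left (hd2 i) hlam.le
    have h3 := minCoeff_le β i
    change |regCoef m Y (Φ *ᵥ ε) i| + lam * |((normGram (m : ℝ) Y)⁻¹ *ᵥ signOn β S) i| < |β i|
    linarith
  · intro j hj
    set η' := η / (1 - a) with hη'
    have hηle : η ≤ η' := by
      rw [hη', le_div_iff₀ h1a]
      have : 0 ≤ a := infNorm_nonneg _
      nlinarith
    have hZj : (Φ * X).col j = Φ *ᵥ X.col j := rfl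
    have h1 : |1 / (m : ℝ) * ((Φ * X).col j ⬝ᵥ residual m Y (Φ *ᵥ ε))| < lam * η / 2 := by
      rw [hZj, ← residual_dotProduct, abs_mul, abs_of_pos (by positivity), one_div,
        inv_mul_lt_iff₀ hm]
      exact hnoise j hj
    -- split the column `X_j` into its regression on `X_S` and the residual
    have hsplit : Φ *ᵥ X.col j = Y *ᵥ regCoef n (cols X S) (X.col j)
        + Φ *ᵥ residual n (cols X S) (X.col j) := by
      rw [residual, Matrix.mulVec_sub, hY, Matrix.mulVec_mulVec]
      abel
    have h2 : 1 / (m : ℝ) * ((Φ * X).col j ⬝ᵥ dualVec Y (signOn β S))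
        = regCoef n (cols X S) (X.col j) ⬝ᵥ signOn β S
          + 1 / (m : ℝ) * (dualVec Y (signOn β S) ⬝ᵥ
            (Φ *ᵥ residual n (cols X S) (X.col j))) := by
      rw [hZj, hsplit, add_dotProduct, mul_add, dualVec, ← dotProduct_normGram_mulVec,
        mulVec_inv_mulVec hAdet, dotProduct_comm (Φ *ᵥ _)]
    have h3 : |regCoef n (cols X S) (X.col j) ⬝ᵥ signOn β S| ≤ 1 - η' := by
      refine le_trans ?_ (sum_abs_regCoef_le hinc (by linarith) hGdet hj)
      refine (Finset.abs_sum_le_sum_abs _ _).trans (Finset.sum_le_sum fun i _ => ?_)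
      rw [abs_mul]
      exact mul_le_of_le_one_right (abs_nonneg _) (abs_signOn_le β S i)
    have h4 : |1 / (m : ℝ) * (dualVec Y (signOn β S) ⬝ᵥ
        (Φ *ᵥ residual n (cols X S) (X.col j)))| < η' / 2 := by
      rw [abs_mul, abs_of_pos (by positivity), one_div, inv_mul_lt_iff₀ hm]
      exact hres j hj
    have h5 : |1 / (m : ℝ) * ((Φ * X).col j ⬝ᵥ dualVec Y (signOn β S))| ≤ 1 - η' / 2 := by
      rw [h2]
      refine (abs_add_le _ _).trans ?_
      linarith
    have h6 := mul_le_mul_of_nonneg_left h5 hlam.le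
    have h7 := mul_le_mul_of_nonneg_left hηle hlam.le
    change |1 / (m : ℝ) * ((Φ * X).col j ⬝ᵥ residual m Y (Φ *ᵥ ε))|
      + lam * |1 / (m : ℝ) * ((Φ * X).col j ⬝ᵥ dualVec Y (signOn β S))| < lam
    linarith

end FiniteSample

section FailureProbability

variable {Ω : Type*} [MeasurableSpace Ω] {P : Measure Ω} {m n p : ℕ}
  {Φ : Ω → Matrix (Fin m) (Fin n) ℝ} {ε : Ω → Fin n → ℝ} {σ : ℝ≥0}

/-- The event that the compressed lasso has a solution and every solution has the signs of `β`. -/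
def AllSignsCorrect {m n p : ℕ} (Φ : Matrix (Fin m) (Fin n) ℝ) (X : Matrix (Fin n) (Fin p) ℝ)
    (β : Fin p → ℝ) (ε : Fin n → ℝ) (lam : ℝ) : Prop :=
  (compressedLasso Φ X β ε lam).Nonempty ∧
    ∀ b ∈ compressedLasso Φ X β ε lam, SameSigns b β ∧ supp b = supp β

lemma measureReal_exists_notMem_le [IsFiniteMeasure P] {S : Finset (Fin p)}
    {A : Fin p → Set Ω} {δ : ℝ} (hA : ∀ j ∉ S, P.real (A j) ≤ δ) :
    P.real {ω | ∃ j, j ∉ S ∧ ω ∈ A j} ≤ ((p : ℝ) - S.card) * δ := by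
  have h1 : {ω | ∃ j, j ∉ S ∧ ω ∈ A j} ⊆ ⋃ j ∈ Sᶜ, A j := by
    rintro ω ⟨j, hj, hω⟩
    simp only [Set.mem_iUnion]
    exact ⟨j, Finset.mem_compl.2 hj, hω⟩
  refine (measureReal_mono h1 (measure_ne_top _ _)).trans
    ((measureReal_biUnion_finset_le _ _).trans ?_)
  refine (Finset.sum_le_sum fun j hj => hA j (Finset.mem_compl.1 hj)).trans (le_of_eq ?_)
  rw [Finset.sum_const, nsmul_eq_mul, Finset.card_compl, Fintype.card_fin,
    Nat.cast_sub (by simpa using S.card_le_univ)]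

/-- An upper bound for the probability that the compressed lasso misses some sign. The summands
belong to: near-orthonormality of the rows of `Φ`, the compressed Gram matrix in Frobenius norm,
its action on `G⁻¹ sgn β`, the norms of the irrelevant columns of `Φ X`, their correlation with
the dual certificate, and the noise off and on the support. -/
noncomputable def failureBound (m n p s : ℕ) (η lam ρ c : ℝ) (σ : ℝ≥0) : ℝ :=
  64 * (m : ℝ) ^ 2 / n + 64 * (s : ℝ) ^ 2 / (m * (η / 2) ^ 2) + 64 * s * (s / c) / m
    + ((p : ℝ) - s) * Real.exp (-(m : ℝ) / 4)
    + ((p : ℝ) - s) * (2 * Real.exp (-(m * η ^ 2 / (16 * s))))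
    + ((p : ℝ) - s) * (2 * Real.exp (-(m * lam ^ 2 * η ^ 2 / (64 * (σ ^ 2 + 1)))))
    + s * (2 * Real.exp (-(c * ρ ^ 2 * m / (32 * (σ ^ 2 + 1)))))

theorem measureReal_not_allSignsCorrect_le (hm : 0 < m) (hn : 0 < n)
    (hmodel : GaussianModel P Φ ε σ)
    {X : Matrix (Fin n) (Fin p) ℝ} {β : Fin p → ℝ} {η lam c : ℝ}
    (hX : ∀ j, ∑ i, X i j ^ 2 = (n : ℝ)) (hinc : Incoherent X (supp β) η)
    (hc : 0 < c) (hac : infNorm (gram X (supp β) - 1) ≤ 1 - c) (hlam : 0 < lam)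
    (hbias : lam * ((1 + 4 / c) * infNorm (gram X (supp β))⁻¹) < minCoeff β / 2) :
    P.real {ω | ¬ AllSignsCorrect (Φ ω) X β (ε ω) lam}
      ≤ failureBound m n p (supp β).card η lam (minCoeff β) c σ := by
  have hP := hmodel.iidGaussian_matrix.isProbabilityMeasure
  have hΦ := hmodel.iidGaussian_matrix
  have hm' : (0 : ℝ) < m := by exact_mod_cast hm
  have hn' : (0 : ℝ) < n := by exact_mod_cast hn
  set S := supp β with hS
  set G := gram X S with hG
  set a := infNorm (G - 1) with ha
  set ρ := minCoeff β with hρ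
  have hρpos : 0 < ρ := minCoeff_pos hinc.1
  have hs : 0 < (S.card : ℝ) := by exact_mod_cast Finset.card_pos.2 hinc.1
  have hcard : Fintype.card {j // j ∈ S} = S.card := Fintype.card_coe S
  have hGsymm : G.IsSymm := normGram_isSymm _ _
  have h1a : 0 < 1 - a := by linarith
  have ha0 : 0 ≤ a := infNorm_nonneg _
  have hη : 0 < η := hinc.2.1
  have hηa : η ≤ 1 - a := by
    have := hinc.2.2.2
    have h0 := infNorm_nonneg ((1 / (n : ℝ)) • ((cols X Sᶜ)ᵀ * cols X S))
    linarith
  have hGcoer := coercive_of_infNorm_le hGsymm (le_refl a)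
  have hGdet : IsUnit G.det := isUnit_det_of_coercive h1a hGcoer
  have hκ : 0 < (1 - a) / 2 := by positivity
  have hcoer : ∀ Y' : Matrix (Fin m) {j // j ∈ S} ℝ, GramClose (η / 2) G Y' →
      ∀ x, (1 - a) / 2 * ∑ i, x i ^ 2 ≤ x ⬝ᵥ (normGram (m : ℝ) Y' *ᵥ x) :=
    fun Y' hY' => hY'.coercive hGsymm (by positivity) (le_refl a) (by linarith)
  have hcolsX : ∀ j, ∑ i, cols X S i j ^ 2 = (n : ℝ) := fun j => hX j
  have hY : ∀ i j, Measurable fun x : Fin m × Fin n → ℝ =>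
      ((Matrix.of fun i j => x (i, j) : Matrix (Fin m) (Fin n) ℝ) * cols X S) i j :=
    measurable_of_mul_apply (cols X S)
  -- one bound for each summand of `failureBound`, in the same order
  have b1 := measureReal_not_rowIsometry_le hn hΦ
  have b2 := measureReal_not_gramClose_le hm hΦ hcolsX hn (r := η / 2) (by positivity)
  have b3 := measureReal_gram_mulVec_le hm hΦ hcolsX hn (u := G⁻¹ *ᵥ signOn β S)
    (B := S.card / c) (by positivity) (by
      have e := mulVec_inv_mulVec hGdet (signOn β S)
      have h1 := dotProduct_le_of_coercive h1a hGcoer e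
      rw [sum_signOn_sq] at h1
      change (G⁻¹ *ᵥ signOn β S) ⬝ᵥ (G *ᵥ (G⁻¹ *ᵥ signOn β S)) ≤ _
      rw [e]
      exact h1.trans (div_le_div_of_nonneg_left hs.le hc (by linarith)))
  rw [hcard] at b2 b3
  have hvcol : ∀ j, ((1 / (n : ℝ≥0) : ℝ≥0) : ℝ) * ∑ i, X.col j i ^ 2 ≤ 1 := fun j => by
    simp only [Matrix.col_apply]
    rw [hX]
    push_cast
    rw [one_div_mul_cancel hn'.ne']
  have b4 := measureReal_exists_notMem_le (P := P) (S := S)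
    (A := fun j => {ω | 4 * (Fintype.card (Fin m) : ℝ) ≤ ∑ l, (Φ ω *ᵥ X.col j) l ^ 2})
    fun j _ => hΦ.measureReal_le_sum_sq_mulVec (hvcol j)
  have b5 := measureReal_exists_notMem_le (P := P) (S := S)
    (A := fun j => {ω | GramClose (η / 2) G (Φ ω * cols X S) ∧
      m * (η / (1 - a) / 2) ≤ |dualVec (Φ ω * cols X S) (signOn β S) ⬝ᵥ
        (Φ ω *ᵥ residual n (cols X S) (X.col j))|})
    fun j _ => measureReal_le_abs_inner_image_residual hm' hn' hΦ
      (transpose_mulVec_residual hn'.ne' hGdet _)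
      ((sum_sq_residual_le hn'.ne' hGdet (X.col j)).trans (hX j).le) hκ hcoer
      (B := m * (S.card / ((1 - a) / 2))) (by positivity) (by rw [sum_signOn_sq]) (by positivity)
  have b6 := measureReal_exists_notMem_le (P := P) (S := S)
    (A := fun j => {ω | (RowIsometry (Φ ω) ∧ GramClose (η / 2) G (Φ ω * cols X S) ∧
        ∑ l, (Φ ω *ᵥ X.col j) l ^ 2 ≤ 4 * m) ∧
      m * (lam * η / 2) ≤ |residual m (Φ ω * cols X S) (Φ ω *ᵥ X.col j) ⬝ᵥ (Φ ω *ᵥ ε ω)|})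
    (δ := 2 * Real.exp (-(m * (lam * η / 2)) ^ 2 / (2 * (2 * (4 * m) * (σ ^ 2 + 1)))))
    fun j _ => by
      have hz : ∀ i, Measurable fun x : Fin m × Fin n → ℝ =>
          ((Matrix.of fun i j => x (i, j) : Matrix (Fin m) (Fin n) ℝ) *ᵥ X.col j) i :=
        fun i => measurable_mulVec_apply (u := fun _ => X.col j)
          (fun a b => measurable_pi_apply (a, b)) (fun _ => measurable_const) i
      exact hmodel.measureReal_le_abs_noise
        (E := {x | RowIsometry (Matrix.of fun i j => x (i, j) : Matrix (Fin m) (Fin n) ℝ) ∧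
          GramClose (η / 2) G
            ((Matrix.of fun i j => x (i, j) : Matrix (Fin m) (Fin n) ℝ) * cols X S) ∧
          ∑ l, ((Matrix.of fun i j => x (i, j) : Matrix (Fin m) (Fin n) ℝ) *ᵥ X.col j) l ^ 2
            ≤ 4 * m})
        (measurableSet_rowIsometry.inter ((measurableSet_gramClose _ _ hY).inter
          (measurableSet_le (Finset.measurable_fun_sum _ fun i _ => (hz i).pow_const 2)
            measurable_const)))
        (fun x hx => hx.1) (measurable_residual_apply _ hY hz) (by positivity)
        (fun x hx => (sum_sq_residual_le hm'.ne'
          (isUnit_det_of_coercive hκ (hcoer _ hx.2.1)) _).trans hx.2.2) (by positivity)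
  have b7 : P.real {ω | ∃ i : {j // j ∈ S}, (RowIsometry (Φ ω) ∧
        GramClose (η / 2) G (Φ ω * cols X S)) ∧
      m * (ρ / 2) ≤ |dualVec (Φ ω * cols X S) (Pi.single i 1) ⬝ᵥ (Φ ω *ᵥ ε ω)|}
      ≤ S.card * (2 * Real.exp (-(m * (ρ / 2)) ^ 2 /
          (2 * (2 * (m * (2 / c)) * (σ ^ 2 + 1))))) := by
    have hone : ∀ i : {j // j ∈ S}, P.real {ω | (RowIsometry (Φ ω) ∧
          GramClose (η / 2) G (Φ ω * cols X S)) ∧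
        m * (ρ / 2) ≤ |dualVec (Φ ω * cols X S) (Pi.single i 1) ⬝ᵥ (Φ ω *ᵥ ε ω)|}
        ≤ 2 * Real.exp (-(m * (ρ / 2)) ^ 2 / (2 * (2 * (m * (2 / c)) * (σ ^ 2 + 1)))) := by
      intro i
      exact hmodel.measureReal_le_abs_noise
        (E := {x | RowIsometry (Matrix.of fun i j => x (i, j) : Matrix (Fin m) (Fin n) ℝ) ∧
          GramClose (η / 2) G
            ((Matrix.of fun i j => x (i, j) : Matrix (Fin m) (Fin n) ℝ) * cols X S)})
        (measurableSet_rowIsometry.inter (measurableSet_gramClose _ _ hY))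
        (fun x hx => hx.1) (measurable_dualVec_apply hY _) (by positivity)
        (fun x hx => by
          refine (sum_sq_mulVec_inv_le hm' hκ (hcoer _ hx.2) _).trans ?_
          refine mul_le_mul_of_nonneg_left ?_ hm'.le
          rw [Finset.sum_eq_single i (fun b _ hb => by simp [hb]) (by simp), Pi.single_eq_same,
            one_pow, one_div, inv_div]
          exact div_le_div_of_nonneg_left (by norm_num) hc (by linarith)) (by positivity)
    rw [← hcard]
    have hsub := measureReal_iUnion_fintype_le (μ := P) (fun i : {j // j ∈ S} =>
      {ω | (RowIsometry (Φ ω) ∧ GramClose (η / 2) G (Φ ω * cols X S)) ∧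
        m * (ρ / 2) ≤ |dualVec (Φ ω * cols X S) (Pi.single i 1) ⬝ᵥ (Φ ω *ᵥ ε ω)|})
    refine le_trans (measureReal_mono fun ω hω => ?_)
      (hsub.trans ((Finset.sum_le_sum fun i _ => hone i).trans (le_of_eq ?_)))
    · exact Set.mem_iUnion.2 hω
    · rw [Finset.sum_const, nsmul_eq_mul, Finset.card_univ]
  have hps : 0 ≤ (p : ℝ) - S.card := by
    have := S.card_le_univ
    rw [Fintype.card_fin] at this
    have : (S.card : ℝ) ≤ p := by exact_mod_cast this
    linarith
  -- comparison of the exponents with those of `failureBound`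
  have b5' : ((p : ℝ) - S.card) * (2 * Real.exp (-(m * (η / (1 - a) / 2)) ^ 2 /
        (2 * (m * (S.card / ((1 - a) / 2))))))
      ≤ ((p : ℝ) - S.card) * (2 * Real.exp (-(m * η ^ 2 / (16 * S.card)))) := by
    refine mul_le_mul_of_nonneg_left (mul_le_mul_of_nonneg_left (Real.exp_le_exp.2 ?_)
      zero_le_two) hps
    have e : -(m * (η / (1 - a) / 2)) ^ 2 / (2 * (m * (S.card / ((1 - a) / 2))))
        = -(m * η ^ 2 / (16 * S.card) / (1 - a)) := by
      field_simp
      ring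
    rw [e, neg_le_neg_iff, le_div_iff₀ h1a]
    exact mul_le_of_le_one_right (by positivity) (by linarith)
  have e6 : -((m : ℝ) * (lam * η / 2)) ^ 2 / (2 * (2 * (4 * m) * ((σ : ℝ) ^ 2 + 1)))
      = -(m * lam ^ 2 * η ^ 2 / (64 * (σ ^ 2 + 1))) := by
    field_simp
    ring
  have e7 : -((m : ℝ) * (ρ / 2)) ^ 2 / (2 * (2 * (m * (2 / c)) * ((σ : ℝ) ^ 2 + 1)))
      = -(c * ρ ^ 2 * m / (32 * (σ ^ 2 + 1))) := by
    field_simp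
    ring
  rw [e6] at b6
  rw [e7] at b7
  rw [Fintype.card_fin] at b4
  have c2 := (measureReal_union_le _ _).trans (add_le_add b1 b2)
  have c3 := (measureReal_union_le _ _).trans (add_le_add c2 b3)
  have c4 := (measureReal_union_le _ _).trans (add_le_add c3 b4)
  have c5 := (measureReal_union_le _ _).trans (add_le_add c4 (b5.trans b5'))
  have c6 := (measureReal_union_le _ _).trans (add_le_add c5 b6)
  have c7 := (measureReal_union_le _ _).trans (add_le_add c6 b7)
  refine (measureReal_mono (fun ω hω => ?_) (measure_ne_top _ _)).trans c7
  by_contra hgood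
  simp only [Set.mem_union, not_or] at hgood
  obtain ⟨⟨⟨⟨⟨⟨g1, g2⟩, g3⟩, g4⟩, g5⟩, g6⟩, g7⟩ := hgood
  have i1 : RowIsometry (Φ ω) := not_not.1 g1
  have i2 : GramClose (η / 2) G (Φ ω * cols X S) := not_not.1 g2
  have i4 : ∀ j ∉ S, ∑ l, (Φ ω *ᵥ X.col j) l ^ 2 ≤ 4 * m := fun j hj =>
    le_of_not_ge fun hlt => g4 ⟨j, hj, hlt⟩
  refine hω (compressedLasso_sameSigns hm' hinc hc hac hlam hbias i2 (not_le.1 g3).le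
    (fun j hj => ?_) (fun j hj => ?_) fun i => ?_)
  · exact lt_of_not_ge fun hlt => g5 ⟨j, hj, i2, hlt⟩
  · exact lt_of_not_ge fun hlt => g6 ⟨j, hj, ⟨i1, i2, i4 j hj⟩, hlt⟩
  · exact lt_of_not_ge fun hlt => g7 ⟨i, ⟨i1, i2⟩, hlt⟩

end FailureProbability

/-! ### Asymptotics -/

section Asymptotics

lemma one_le_C₁ : 1 ≤ C₁ := by
  have h1 : Real.sqrt (6 * Real.pi) ≤ 10 := by
    rw [Real.sqrt_le_left (by norm_num)]
    linarith [Real.pi_lt_four]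
  have h2 : 0 < Real.sqrt (6 * Real.pi) := Real.sqrt_pos.2 (by positivity)
  rw [C₁, le_div_iff₀ h2]
  linarith [Real.exp_one_gt_d9]

/-- The upper bound on `m` forces `16 m² log n ≤ n` and `n ≥ 2`. -/
lemma sixteen_mul_sq_mul_log_le {m n : ℕ} (hm : 0 < m)
    (h : (m : ℝ) ≤ Real.sqrt ((n : ℝ) / (16 * Real.log n))) :
    0 < Real.log n ∧ 16 * (m : ℝ) ^ 2 * Real.log n ≤ n ∧ m ≤ n := by
  have hm' : (1 : ℝ) ≤ m := by exact_mod_cast hm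
  have hn : 2 ≤ n := by
    by_contra hlt
    -- `log 0 = log 1 = 0`, so the quotient and the square root vanish
    have h0 : Real.log n = 0 := by
      interval_cases n <;> simp
    rw [h0, mul_zero, div_zero, Real.sqrt_zero] at h
    linarith
  have hn' : (2 : ℝ) ≤ n := by exact_mod_cast hn
  have hlog2 : Real.log 2 ≤ Real.log n := Real.log_le_log (by norm_num) hn'
  have hlog : 0 < Real.log n := by linarith [Real.log_two_gt_d9]
  have h1 : (m : ℝ) ^ 2 ≤ (n : ℝ) / (16 * Real.log n) :=
    (Real.le_sqrt' (by linarith)).1 h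
  rw [le_div_iff₀ (by positivity)] at h1
  refine ⟨hlog, by linarith, ?_⟩
  have h2 : (m : ℝ) ≤ n := by
    have h3 : (1 : ℝ) ≤ 16 * Real.log n := by linarith [Real.log_two_gt_d9]
    nlinarith [mul_le_mul_of_nonneg_left h3 (sq_nonneg (m : ℝ))]
  exact_mod_cast h2

set_option maxHeartbeats 600000 in
/-- The failure probability in terms of `log n`, of `Q = m η² λ² / log (p - s)`, and of
`τ = σ² + 1`, in the regime where the noise level on the support is below the signal strength `ρ`. -/
lemma failureBound_le {m n p s : ℕ} {η lam ρ c Q : ℝ} {σ : ℝ≥0} (hm : 0 < m) (hs : 1 ≤ s)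
    (hps : s + 2 ≤ p) (hη : 0 < η) (hη1 : η ≤ 1) (hc : 0 < c)
    (hlog : 0 < Real.log n) (hup : 16 * (m : ℝ) ^ 2 * Real.log n ≤ n)
    (hlow : (16 * C₁ * (s : ℝ) ^ 2 / η ^ 2 + 4 * C₂ * s / η)
      * (Real.log p + 2 * Real.log n + Real.log (2 * ((s : ℝ) + 1))) ≤ m)
    (hQ : m * η ^ 2 * lam ^ 2 = Q * Real.log ((p : ℝ) - s))
    (hQ1 : 64 * ((σ : ℝ) ^ 2 + 1) ≤ Q)
    (hρ : Real.log s + m * lam ^ 2 / 4 ≤ c * ρ ^ 2 * m / (32 * (σ ^ 2 + 1))) :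
    failureBound m n p s η lam ρ c σ ≤ 12 / Real.log n + 2 / c / Real.log n
      + 3 * Real.exp (-Real.log n)
      + 2 * Real.exp (-(Real.log 2 * (Q / (64 * (σ ^ 2 + 1)) - 1)))
      + 2 * Real.exp (-(Real.log 2 / 4 * Q)) := by
  set τ := (σ : ℝ) ^ 2 + 1 with hτ
  have hτpos : 0 < τ := by positivity
  set L := Real.log p + 2 * Real.log n + Real.log (2 * ((s : ℝ) + 1)) with hL
  have hm' : (0 : ℝ) < m := by exact_mod_cast hm
  have hs' : (1 : ℝ) ≤ s := by exact_mod_cast hs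
  have hps' : (s : ℝ) + 2 ≤ p := by exact_mod_cast hps
  have hp : (0 : ℝ) < p := by linarith
  have hn : (0 : ℝ) < n := lt_of_lt_of_le (by positivity) hup
  have hlogp : 0 ≤ Real.log p := Real.log_nonneg (by linarith)
  have hlogs : 0 ≤ Real.log (2 * ((s : ℝ) + 1)) := Real.log_nonneg (by linarith)
  have hLn : 2 * Real.log n ≤ L := by linarith
  have hLpos : 0 < L := by linarith
  have hmL : 16 * (s : ℝ) ^ 2 * L ≤ m * η ^ 2 := by
    have h1 : 16 * (s : ℝ) ^ 2 / η ^ 2 * L ≤ m := by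
      refine le_trans (mul_le_mul_of_nonneg_right ?_ hLpos.le) hlow
      have h2 : 16 * (s : ℝ) ^ 2 / η ^ 2 ≤ 16 * C₁ * (s : ℝ) ^ 2 / η ^ 2 := by
        gcongr
        linarith [one_le_C₁]
      have h3 : 0 ≤ 4 * C₂ * s / η := by
        have : 0 ≤ C₂ := Real.sqrt_nonneg _
        positivity
      linarith
    have h2 : 16 * (s : ℝ) ^ 2 / η ^ 2 * L = 16 * (s : ℝ) ^ 2 * L / η ^ 2 := by ring
    rwa [h2, div_le_iff₀ (by positivity)] at h1
  have hη2 : η ^ 2 ≤ 1 := pow_le_one₀ hη.le hη1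
  have hs2 : (1 : ℝ) ≤ (s : ℝ) ^ 2 := one_le_pow₀ hs'
  have hm16 : 16 * (s : ℝ) ^ 2 * L ≤ m := hmL.trans (mul_le_of_le_one_right hm'.le hη2)
  have hss : (s : ℝ) ≤ (s : ℝ) ^ 2 := le_self_pow₀ hs' two_ne_zero
  have hL16 : 16 * L ≤ m := by
    have := mul_le_mul_of_nonneg_right hs2 hLpos.le
    linarith
  have hpexp : ((p : ℝ) - s) * Real.exp (-L) ≤ Real.exp (-Real.log n) := by
    have h1 : ((p : ℝ) - s) ≤ Real.exp (Real.log p) := by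
      rw [Real.exp_log hp]; linarith
    refine (mul_le_mul_of_nonneg_right h1 (Real.exp_pos _).le).trans ?_
    rw [← Real.exp_add]
    refine Real.exp_le_exp.2 ?_
    linarith
  have hq0 : 0 ≤ (p : ℝ) - s := by linarith
  have t1 : 64 * (m : ℝ) ^ 2 / n ≤ 4 / Real.log n := by
    rw [div_le_div_iff₀ hn hlog]
    linarith
  have t2 : 64 * (s : ℝ) ^ 2 / (m * (η / 2) ^ 2) ≤ 8 / Real.log n := by
    rw [div_le_div_iff₀ (by positivity) hlog]
    have := mul_le_mul_of_nonneg_left hLn (show 0 ≤ 16 * (s : ℝ) ^ 2 by positivity)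
    linarith
  have t3 : 64 * s * (s / c) / m ≤ 2 / c / Real.log n := by
    rw [show (64 * s * (s / c) / m : ℝ) = 64 * (s : ℝ) ^ 2 / m / c by ring,
      show 2 / c / Real.log n = 2 / Real.log n / c by ring]
    refine div_le_div_of_nonneg_right ?_ hc.le
    rw [div_le_div_iff₀ hm' hlog]
    have := mul_le_mul_of_nonneg_left hLn (show 0 ≤ 16 * (s : ℝ) ^ 2 by positivity)
    linarith
  have t4 : ((p : ℝ) - s) * Real.exp (-(m : ℝ) / 4) ≤ Real.exp (-Real.log n) := by
    refine le_trans (mul_le_mul_of_nonneg_left (Real.exp_le_exp.2 ?_) hq0) hpexp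
    linarith
  have t5 : ((p : ℝ) - s) * (2 * Real.exp (-(m * η ^ 2 / (16 * s))))
      ≤ 2 * Real.exp (-Real.log n) := by
    have h1 : L ≤ m * η ^ 2 / (16 * s) := by
      rw [le_div_iff₀ (by positivity)]
      have := mul_le_mul_of_nonneg_right hss hLpos.le
      linarith
    have h2 := mul_le_mul_of_nonneg_left (Real.exp_le_exp.2 (neg_le_neg h1)) hq0
    linarith
  have hlq : Real.log 2 ≤ Real.log ((p : ℝ) - s) := Real.log_le_log (by norm_num) (by linarith)
  have hl2 : 0 < Real.log 2 := Real.log_pos (by norm_num)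
  have hQpos : 0 < Q := lt_of_lt_of_le (by positivity) hQ1
  have t6 : ((p : ℝ) - s) * (2 * Real.exp (-(m * lam ^ 2 * η ^ 2 / (64 * τ))))
      ≤ 2 * Real.exp (-(Real.log 2 * (Q / (64 * τ) - 1))) := by
    have h1 : (p : ℝ) - s = Real.exp (Real.log ((p : ℝ) - s)) := by
      rw [Real.exp_log (by linarith)]
    have h2 : m * lam ^ 2 * η ^ 2 / (64 * τ) = Real.log ((p : ℝ) - s) * (Q / (64 * τ)) := by
      rw [show (m : ℝ) * lam ^ 2 * η ^ 2 = m * η ^ 2 * lam ^ 2 by ring, hQ]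
      ring
    have h3 : 0 ≤ Q / (64 * τ) - 1 := by
      rw [sub_nonneg, le_div_iff₀ (by positivity)]
      linarith
    rw [h2, mul_left_comm]
    refine mul_le_mul_of_nonneg_left ?_ zero_le_two
    nth_rewrite 1 [h1]
    rw [← Real.exp_add]
    refine Real.exp_le_exp.2 ?_
    have := mul_le_mul_of_nonneg_right hlq h3
    linarith
  have t7 : s * (2 * Real.exp (-(c * ρ ^ 2 * m / (32 * τ))))
      ≤ 2 * Real.exp (-(Real.log 2 / 4 * Q)) := by
    have h1 : (s : ℝ) = Real.exp (Real.log s) := by rw [Real.exp_log (by linarith)]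
    rw [mul_left_comm]
    refine mul_le_mul_of_nonneg_left ?_ zero_le_two
    nth_rewrite 1 [h1]
    rw [← Real.exp_add]
    refine Real.exp_le_exp.2 ?_
    have h2 : Q * Real.log 2 ≤ m * lam ^ 2 := by
      have h3 := mul_le_mul_of_nonneg_left hlq hQpos.le
      have h4 : m * η ^ 2 * lam ^ 2 ≤ m * lam ^ 2 := by
        have := mul_le_mul_of_nonneg_left hη2 (show 0 ≤ m * lam ^ 2 by positivity)
        linarith
      linarith
    linarith
  rw [failureBound]
  have e1 : 12 / Real.log n = 4 / Real.log n + 8 / Real.log n := by ring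
  linarith

end Asymptotics

/-- A probability bounded below by `1 - δ_k` with `δ_k → 0` tends to one; no measurability of the
events is needed. -/
lemma tendsto_measure_one_of_compl_le {Ω : ℕ → Type*} [∀ k, MeasurableSpace (Ω k)]
    {P : ∀ k, Measure (Ω k)} [∀ k, IsProbabilityMeasure (P k)] {A B : ∀ k, Set (Ω k)}
    {δ : ℕ → ℝ} (hδ : Tendsto δ atTop (𝓝 0)) (hAB : ∀ k, A k ⊆ B k)
    (h : ∀ᶠ k in atTop, (P k).real (A k)ᶜ ≤ δ k) :
    Tendsto (fun k => P k (B k)) atTop (𝓝 1) := by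
  have h1 : Tendsto (fun k => (1 : ℝ≥0∞) - ENNReal.ofReal (δ k)) atTop (𝓝 1) := by
    have := ENNReal.Tendsto.sub (tendsto_const_nhds (x := (1 : ℝ≥0∞)))
      (ENNReal.tendsto_ofReal hδ) (Or.inl ENNReal.one_ne_top)
    simpa using this
  refine tendsto_of_tendsto_of_tendsto_of_le_of_le' h1 tendsto_const_nhds ?_
    (Eventually.of_forall fun k => prob_le_one)
  filter_upwards [h] with k hk
  rw [tsub_le_iff_right]
  have h2 : P k (A k)ᶜ ≤ ENNReal.ofReal (δ k) := by
    rw [← ENNReal.ofReal_toReal (measure_ne_top (P k) (A k)ᶜ)]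
    exact ENNReal.ofReal_le_ofReal hk
  calc (1 : ℝ≥0∞) = P k Set.univ := measure_univ.symm
    _ ≤ P k (A k ∪ (A k)ᶜ) := by rw [Set.union_compl_self]
    _ ≤ P k (A k) + P k (A k)ᶜ := measure_union_le _ _
    _ ≤ P k (B k) + ENNReal.ofReal (δ k) := add_le_add (measure_mono (hAB k)) h2

end CompressedLasso

theorem theorem1
    {Ω : ℕ → Type*} [∀ k, MeasurableSpace (Ω k)]
    (P : ∀ k, Measure (Ω k)) [∀ k, IsProbabilityMeasure (P k)]
    -- dimensions, with the number `m` of compressed examples tending to infinity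
    (m n p : ℕ → ℕ) (hm : Tendsto m atTop atTop)
    -- deterministic designs, true parameters, support sizes, incoherence parameters
    (X : ∀ k, Matrix (Fin (n k)) (Fin (p k)) ℝ)
    (β : ∀ k, Fin (p k) → ℝ)
    (s : ℕ → ℕ) (hs : ∀ k, s k = (CompressedLasso.supp (β k)).card)
    (η lam : ℕ → ℝ) (σ : ℝ≥0)
    -- compression matrices and noise
    (Φ : ∀ k, Ω k → Matrix (Fin (m k)) (Fin (n k)) ℝ)
    (ε : ∀ k, Ω k → Fin (n k) → ℝ)
    (hmodel : ∀ k, CompressedLasso.GaussianModel (P k) (Φ k) (ε k) σ)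
    -- normalized columns and incoherence
    (hX : ∀ k j, ∑ i, X k i j ^ 2 = (n k : ℝ))
    (hinc : ∀ k, CompressedLasso.Incoherent (X k) (CompressedLasso.supp (β k)) (η k))
    -- automatic if `η` is constant
    (hbdd : ∃ c : ℝ, 0 < c ∧ ∀ k,
      CompressedLasso.infNorm (CompressedLasso.gram (X k) (CompressedLasso.supp (β k)) - 1)
        ≤ 1 - c)
    -- `log (p - s)` is positive
    (hps : ∀ k, s k + 2 ≤ p k)
    -- lower and upper bound on `m`
    (hlow : ∀ k,
      (16 * CompressedLasso.C₁ * (s k : ℝ) ^ 2 / η k ^ 2 + 4 * CompressedLasso.C₂ * s k / η k)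
        * (Real.log (p k) + 2 * Real.log (n k) + Real.log (2 * ((s k : ℝ) + 1))) ≤ (m k : ℝ))
    (hup : ∀ k, (m k : ℝ) ≤ Real.sqrt ((n k : ℝ) / (16 * Real.log (n k))))
    -- the regularization parameter
    (hlam_pos : ∀ k, 0 < lam k) (hlam : Tendsto lam atTop (𝓝 0))
    (ha : Tendsto
      (fun k => (m k : ℝ) * η k ^ 2 * lam k ^ 2 / Real.log ((p k : ℝ) - (s k : ℝ)))
      atTop atTop)
    (hb : Tendsto
      (fun k => 1 / CompressedLasso.minCoeff (β k) *
        (Real.sqrt (Real.log (s k) / (m k : ℝ)) +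
          lam k * CompressedLasso.infNorm
            (CompressedLasso.gram (X k) (CompressedLasso.supp (β k)))⁻¹))
      atTop (𝓝 0)) :
    CompressedLasso.Sparsistent P
      (fun k ω => CompressedLasso.compressedLasso (Φ k ω) (X k) (β k) (ε k ω) (lam k)) β ∧
    CompressedLasso.SignConsistent P
      (fun k ω => CompressedLasso.compressedLasso (Φ k ω) (X k) (β k) (ε k ω) (lam k)) β ∧
    Tendsto
      (fun k => P k {ω |
        (CompressedLasso.compressedLasso (Φ k ω) (X k) (β k) (ε k ω) (lam k)).Nonempty ∧
        ∀ b ∈ CompressedLasso.compressedLasso (Φ k ω) (X k) (β k) (ε k ω) (lam k),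
          CompressedLasso.SameSigns b (β k) ∧
          CompressedLasso.supp b = CompressedLasso.supp (β k)})
      atTop (𝓝 1) := by
  obtain ⟨c, hc, hac⟩ := hbdd
  set τ : ℝ := (σ : ℝ) ^ 2 + 1 with hτ
  have hτpos : 0 < τ := by positivity
  set Q : ℕ → ℝ := fun k =>
    (m k : ℝ) * η k ^ 2 * lam k ^ 2 / Real.log ((p k : ℝ) - (s k : ℝ)) with hQdef
  set N : ℕ → ℝ := fun k => CompressedLasso.infNorm
    (CompressedLasso.gram (X k) (CompressedLasso.supp (β k)))⁻¹ with hNdef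
  set ρ : ℕ → ℝ := fun k => CompressedLasso.minCoeff (β k) with hρdef
  set ψ : ℕ → ℝ := fun k => 1 / ρ k * (Real.sqrt (Real.log (s k) / (m k : ℝ)) + lam k * N k)
    with hψdef
  have hm0 : ∀ᶠ k in atTop, 0 < m k := hm.eventually_gt_atTop 0
  have hnat : Tendsto n atTop atTop := by
    refine tendsto_atTop_mono' _ ?_ hm
    filter_upwards [hm0] with k hk
    exact (CompressedLasso.sixteen_mul_sq_mul_log_le hk (hup k)).2.2
  have hlogn : Tendsto (fun k => Real.log (n k)) atTop atTop :=
    Real.tendsto_log_atTop.comp (tendsto_natCast_atTop_atTop.comp hnat)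
  set δ : ℕ → ℝ := fun k => 12 / Real.log (n k) + 2 / c / Real.log (n k)
      + 3 * Real.exp (-Real.log (n k))
      + 2 * Real.exp (-(Real.log 2 * (Q k / (64 * τ) - 1)))
      + 2 * Real.exp (-(Real.log 2 / 4 * Q k)) with hδdef
  have hl2 : 0 < Real.log 2 := Real.log_pos (by norm_num)
  have hδ : Tendsto δ atTop (𝓝 0) := by
    have d1 := hlogn.const_div_atTop 12
    have d2 := hlogn.const_div_atTop (2 / c)
    have d3 := (Real.tendsto_exp_neg_atTop_nhds_zero.comp hlogn).const_mul 3
    have e4 : Tendsto (fun k => Real.log 2 * (Q k / (64 * τ) - 1)) atTop atTop :=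
      (tendsto_atTop_add_const_right _ (-1) (ha.atTop_div_const (by positivity))).const_mul_atTop
        hl2
    have d4 := (Real.tendsto_exp_neg_atTop_nhds_zero.comp e4).const_mul 2
    have e5 : Tendsto (fun k => Real.log 2 / 4 * Q k) atTop atTop :=
      ha.const_mul_atTop (by positivity)
    have d5 := (Real.tendsto_exp_neg_atTop_nhds_zero.comp e5).const_mul 2
    simpa [Function.comp_def] using (((d1.add d2).add d3).add d4).add d5
  have hQlarge : ∀ᶠ k in atTop, 64 * τ ≤ Q k := ha.eventually_ge_atTop _
  have hψ1 : ∀ᶠ k in atTop, ψ k < 1 / (2 * (1 + 4 / c)) :=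
    hb.eventually_lt_const (by positivity)
  have hψ2 : ∀ᶠ k in atTop, ψ k ^ 2 < c / (32 * τ) := by
    have : Tendsto (fun k => ψ k ^ 2) atTop (𝓝 0) := by
      simpa using hb.pow 2
    exact this.eventually_lt_const (by positivity)
  have main : ∀ᶠ k in atTop, (P k).real
      {ω | CompressedLasso.AllSignsCorrect (Φ k ω) (X k) (β k) (ε k ω) (lam k)}ᶜ ≤ δ k := by
    filter_upwards [hm0, hQlarge, hψ1, hψ2] with k hk hQk hψ1k hψ2k
    obtain ⟨hlog, hupk, hmn⟩ := CompressedLasso.sixteen_mul_sq_mul_log_le hk (hup k)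
    have hmk : (0 : ℝ) < m k := by exact_mod_cast hk
    have hρk : 0 < ρ k := CompressedLasso.minCoeff_pos (hinc k).1
    have hNk : 1 / 2 ≤ N k :=
      CompressedLasso.half_le_infNorm_gram_inv (hinc k).1 (by linarith [hac k])
    have hs1 : 1 ≤ s k := by
      rw [hs k]; exact Finset.card_pos.2 (hinc k).1
    have hs1' : (1 : ℝ) ≤ s k := by exact_mod_cast hs1
    have hlogs : 0 ≤ Real.log (s k) := Real.log_nonneg hs1'
    have hψρ : ρ k * ψ k = Real.sqrt (Real.log (s k) / (m k : ℝ)) + lam k * N k := by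
      simp only [hψdef]
      rw [← mul_assoc, mul_one_div_cancel hρk.ne', one_mul]
    have hlN : 0 ≤ lam k * N k := mul_nonneg (hlam_pos k).le (by linarith)
    have hsq := Real.sqrt_nonneg (Real.log (s k) / (m k : ℝ))
    have hbias : lam k * ((1 + 4 / c) * N k) < ρ k / 2 := by
      have hc4 : 0 < 1 + 4 / c := by positivity
      rw [lt_div_iff₀ (by positivity)] at hψ1k
      have h1 : lam k * N k ≤ ρ k * ψ k := by linarith
      have h2 := mul_le_mul_of_nonneg_right h1 hc4.le
      have h3 := mul_lt_mul_of_pos_left hψ1k hρk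
      nlinarith
    have hsig : Real.log (s k) + m k * lam k ^ 2 / 4
        ≤ c * ρ k ^ 2 * m k / (32 * ((σ : ℝ) ^ 2 + 1)) := by
      have h1 : (ρ k * ψ k) ^ 2 * m k ≤ c * ρ k ^ 2 * m k / (32 * τ) := by
        have h2 := mul_le_mul_of_nonneg_left hψ2k.le (show 0 ≤ ρ k ^ 2 * m k by positivity)
        calc (ρ k * ψ k) ^ 2 * m k = ρ k ^ 2 * m k * ψ k ^ 2 := by ring
          _ ≤ ρ k ^ 2 * m k * (c / (32 * τ)) := h2
          _ = c * ρ k ^ 2 * m k / (32 * τ) := by ring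
      refine le_trans ?_ h1
      have h3 : Real.log (s k) / m k + lam k ^ 2 / 4 ≤ (ρ k * ψ k) ^ 2 := by
        rw [hψρ]
        have h4 := Real.sq_sqrt (show 0 ≤ Real.log (s k) / (m k : ℝ) by positivity)
        have h5 : lam k / 2 ≤ lam k * N k := by
          have := mul_le_mul_of_nonneg_left hNk (hlam_pos k).le
          linarith
        have h6 : (lam k / 2) ^ 2 ≤ (lam k * N k) ^ 2 :=
          pow_le_pow_left₀ (by linarith [hlam_pos k]) h5 2
        nlinarith [mul_nonneg hsq hlN]
      have h4 := mul_le_mul_of_nonneg_right h3 hmk.le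
      have h5 : (Real.log (s k) / m k + lam k ^ 2 / 4) * m k
          = Real.log (s k) + m k * lam k ^ 2 / 4 := by
        field_simp
      linarith
    have hlq : 0 < Real.log ((p k : ℝ) - s k) := by
      have : (s k : ℝ) + 2 ≤ p k := by exact_mod_cast hps k
      exact Real.log_pos (by linarith)
    have h1 := CompressedLasso.measureReal_not_allSignsCorrect_le hk (hk.trans_le hmn) (hmodel k)
      (hX k) (hinc k) hc (hac k) (hlam_pos k) hbias
    rw [← hs k] at h1
    refine h1.trans ?_
    exact CompressedLasso.failureBound_le hk hs1 (hps k) (hinc k).2.1 (hinc k).2.2.1 hc hlog hupk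
      (hlow k) (div_mul_cancel₀ _ hlq.ne').symm hQk hsig
  refine ⟨?_, ?_, ?_⟩
  · refine CompressedLasso.tendsto_measure_one_of_compl_le hδ (fun k ω hω => ?_) main
    obtain ⟨⟨b, hb⟩, hall⟩ := hω
    exact ⟨b, hb, (hall b hb).2⟩
  · refine CompressedLasso.tendsto_measure_one_of_compl_le hδ (fun k ω hω => ?_) main
    obtain ⟨⟨b, hb⟩, hall⟩ := hω
    exact ⟨b, hb, (hall b hb).1⟩
  · exact CompressedLasso.tendsto_measure_one_of_compl_le hδ (fun k => subset_rfl) main
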